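/- Conventions. All point sets and curves are in the Euclidean plane $\mathbb{R}^2$. For $J\subseteq\mathbb{R}^2$, the stabbing number $\operatorname{stab}(J)\in\{0,1,2,\dots\}\cup\{\infty\}$ is the supremum of $|\ell\cap J|$ over all lines $\ell$ that do not overlap $J$ along a segment, i.e. such that $\ell\cap J$ contains no segment of positive length. A Jordan curve is the image of a circle under a continuous injective map to the plane, and a $d$-curve is a Jordan curve $J$ with $\operatorname{stab}(J)\le d$. The degree $d(X)$ of a finite point set $X$ is the smallest $d$ such that there is a $d$-curve containing $X$. Two point sets are linearly separable if some line has all points of the first set strictly on one side and all points of the second set strictly on the other side. Theorem 4.6. There are an absolute constant $C>0$ and an $m_0$ such that the following holds for every $m\ge m_0$. Let $A_1,\dots,A_m$ be finite, pairwise linearly separable point sets such that no three distinct points of $\bigcup_i A_i$ are collinear. For each $i$ let $B_i$ be a $d(A_i)$-curve containing $A_i$, and suppose that no two of the curves overlap, in the sense that $B_i\cap B_j$ is countable (for example, empty or finite) for all $i\ne j$. Then $$d\Big(\bigcup_{i=1}^m A_i\Big)\;\le\;\operatorname{stab}\Big(\bigcup_{i=1}^m B_i\Big)+C\sqrt m .$$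 -/

import Mathlib

open scoped ENNReal

/-- The Euclidean plane. -/
abbrev Plane : Type := EuclideanSpace ℝ (Fin 2)

/-- `L` is a line in the plane: the solution set of `a x + b y = c` with `(a, b) ≠ (0, 0)`. -/
def IsLine (L : Set Plane) : Prop :=
  ∃ a b c : ℝ, (a ≠ 0 ∨ b ≠ 0) ∧ L = {p : Plane | a * p 0 + b * p 1 = c}

/-- `S` contains a segment of positive length. -/
def ContainsSegment (S : Set Plane) : Prop :=
  ∃ p q : Plane, p ≠ q ∧ segment ℝ p q ⊆ S

/-- The stabbing number of a planar set `J`: the largest number of points in which a line can meet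
`J`, where lines that overlap `J` along a segment of positive length are not taken into account.
A line that meets `J` in infinitely many points without overlapping it along a segment
contributes `⊤`. -/
noncomputable def stab (J : Set Plane) : ℕ∞ :=
  ⨆ (L : Set Plane) (_ : IsLine L) (_ : ¬ ContainsSegment (L ∩ J)), (L ∩ J).encard

/-- A Jordan curve (simple closed curve): the image of a circle under a continuous injection. -/
def IsJordanCurve (J : Set Plane) : Prop :=
  ∃ γ : Circle → Plane, Continuous γ ∧ Function.Injective γ ∧ Set.range γ = J

/-- A `d`-curve is a Jordan curve with stabbing number at most `d`. -/
def IsDCurve (d : ℕ∞) (J : Set Plane) : Prop :=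
  IsJordanCurve J ∧ stab J ≤ d

/-- The degree of `X`: the smallest `d` such that there is a `d`-curve through all points of `X`.
The infimum is taken in `ℕ∞`, which is well-ordered, so it is attained (the value `⊤` means that
there is no such curve with `d` finite). -/
noncomputable def curveDegree (X : Set Plane) : ℕ∞ :=
  sInf {d : ℕ∞ | ∃ J : Set Plane, IsDCurve d J ∧ X ⊆ J}

/-- General position: no three distinct points of `X` are collinear. -/
def InGeneralPosition (X : Set Plane) : Prop :=
  ∀ p ∈ X, ∀ q ∈ X, ∀ r ∈ X, p ≠ q → p ≠ r → q ≠ r → ¬ Collinear ℝ {p, q, r}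

/-- `R` and `S` are linearly separable: some line `a x + b y = c` has all points of `R`
(strictly) on one side and all points of `S` (strictly) on the other side. -/
def LinearlySeparable (R S : Set Plane) : Prop :=
  ∃ a b c : ℝ, (a ≠ 0 ∨ b ≠ 0) ∧
    (∀ p ∈ R, a * p 0 + b * p 1 < c) ∧ (∀ q ∈ S, c < a * q 0 + b * q 1)

/-! ### Sums over consecutive pairs of open and cyclic walks -/

section PathSums

variable {α β M : Type*}

/-! Replace each curve `B i` by the closed walk that visits the points of `A i` in the order in
which the curve does. By the intermediate value theorem, a line that misses `A i` is crossed by this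
walk at most as often as it meets `B i` (`IsJordanCurve.exists_closed_walk`). A small translation
makes the line avoid all common points of the curves and all overlaps with them, so the walks
together cross it at most `stab (⋃ i, B i)` times (`sum_pathSum_signFlip_le_stab`).

Welzl's theorem (`exists_path_low_stabbing`) joins one base point per walk by a path that crosses
every line `O(√m)` times. Splicing the closed walks into this path gives a single walk through all
points. Skipping repeated vertices adds no crossings, and closing up adds at most one. Among all
tours obeying the resulting crossing bound, one of minimal Euclidean length has no crossing sides,
because uncrossing shortens the tour and adds no crossings with lines. This tour is a simple polygon
(`curveDegree_le_of_cycSum_le`), and its stabbing number is controlled by lines that miss all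
vertices (`stab_closedPolygon_le`).

Welzl's theorem rests on Haussler's packing argument: for any weights on half-planes, some two of
`n` points are separated by only an `O(1/√n)` share of the weight (`exists_lightly_separated_pair`).
One point of the pair is removed, the separating half-planes are made heavier, and the point is put
back as a detour after recursion. The final total weight is `exp (O(√n))` times the initial one,
which bounds the crossings of each single half-plane logarithmically. -/

/-- The sum of `g` over the pairs of consecutive entries of a list. -/
def pathSum [AddCommMonoid M] (g : α → α → M) : List α → M
  | [] => 0
  | [_] => 0
  | x :: y :: l => g x y + pathSum g (y :: l)

/-- The sum of `g` over the pairs of cyclically consecutive entries of a list. -/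
def cycSum [AddCommMonoid M] (g : α → α → M) : List α → M
  | [] => 0
  | x :: l => pathSum g (x :: l ++ [x])

theorem pathSum_append [AddCommMonoid M] (g : α → α → M) (l₁ : List α) (x : α) (l₂ : List α) :
    pathSum g (l₁ ++ x :: l₂) = pathSum g (l₁ ++ [x]) + pathSum g (x :: l₂) := by
  induction l₁ with
  | nil => simp [pathSum]
  | cons a l ih =>
    cases l with
    | nil => simp [pathSum]
    | cons b l => simp only [List.cons_append, pathSum] at ih ⊢; rw [ih, add_assoc]

theorem pathSum_reverse [AddCommMonoid M] (g : α → α → M) (hg : ∀ x y, g x y = g y x)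
    (l : List α) : pathSum g l.reverse = pathSum g l := by
  induction l with
  | nil => rfl
  | cons a l ih =>
    cases l with
    | nil => rfl
    | cons b l =>
      simp only [List.reverse_cons, List.append_assoc, List.cons_append,
        List.nil_append] at ih ⊢
      rw [pathSum_append, ih]
      simp [pathSum, hg a b, add_comm]

theorem pathSum_map [AddCommMonoid M] (f : β → α) (g : α → α → M) (l : List β) :
    pathSum g (l.map f) = pathSum (fun x y => g (f x) (f y)) l := by
  induction l with
  | nil => rfl
  | cons a l ih =>
    cases l with
    | nil => rfl
    | cons b l => simp only [List.map_cons, pathSum] at ih ⊢; rw [ih]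

theorem pathSum_eq_sum_range [AddCommMonoid M] (g : α → α → M) (d : α) (l : List α) :
    pathSum g l = ∑ k ∈ Finset.range (l.length - 1), g (l.getD k d) (l.getD (k + 1) d) := by
  induction l with
  | nil => rfl
  | cons a l ih =>
    cases l with
    | nil => rfl
    | cons b l =>
      simp only [pathSum, List.length_cons, Nat.add_sub_cancel] at ih ⊢
      rw [Finset.sum_range_succ', ih, add_comm]
      simp

theorem cycSum_eq_sum_range [AddCommMonoid M] (g : α → α → M) (d : α) (l : List α) :
    cycSum g l = ∑ k ∈ Finset.range l.length,
      g (l.getD (k % l.length) d) (l.getD ((k + 1) % l.length) d) := by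
  cases l with
  | nil => rfl
  | cons x l =>
    rw [cycSum, pathSum_eq_sum_range g d]
    have hlen : (x :: l ++ [x]).length - 1 = (x :: l).length := by simp
    rw [hlen]
    refine Finset.sum_congr rfl fun k hk => ?_
    rw [Finset.mem_range] at hk
    have h1 : (x :: l ++ [x]).getD k d = (x :: l).getD (k % (x :: l).length) d := by
      rw [Nat.mod_eq_of_lt hk, List.getD_append _ _ _ _ hk]
    have h2 : (x :: l ++ [x]).getD (k + 1) d = (x :: l).getD ((k + 1) % (x :: l).length) d := by
      rcases Nat.lt_or_ge (k + 1) (x :: l).length with h | h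
      · rw [Nat.mod_eq_of_lt h, List.getD_append _ _ _ _ h]
      · have h' : k + 1 = (x :: l).length := by omega
        rw [h', Nat.mod_self, List.getD_append_right _ _ _ _ le_rfl]
        simp
    rw [h1, h2]

/-- A cyclic sum splits at two entries of the cycle. -/
theorem cycSum_append [AddCommMonoid M] (g : α → α → M) (x y : α) (a b : List α) :
    cycSum g ((x :: a) ++ (y :: b)) = pathSum g ((x :: a) ++ [y]) + pathSum g ((y :: b) ++ [x]) := by
  rw [List.cons_append, cycSum, List.cons_append (a := y), ← pathSum_append]
  simp

theorem cycSum_append_comm [AddCommMonoid M] (g : α → α → M) (a b : List α) :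
    cycSum g (a ++ b) = cycSum g (b ++ a) := by
  cases a with
  | nil => simp
  | cons x a =>
    cases b with
    | nil => simp
    | cons y b => rw [cycSum_append, cycSum_append, add_comm]

theorem cycSum_rotate [AddCommMonoid M] (g : α → α → M) (l : List α) (n : ℕ) :
    cycSum g (l.rotate n) = cycSum g l := by
  rcases Nat.lt_or_ge l.length n with h | h
  · rw [← List.rotate_mod]
    rcases Nat.eq_zero_or_pos l.length with h0 | h0
    · simp [List.length_eq_zero_iff.1 h0]
    · rw [List.rotate_eq_drop_append_take (Nat.mod_lt _ h0).le, cycSum_append_comm,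
        List.take_append_drop]
  · rw [List.rotate_eq_drop_append_take h, cycSum_append_comm, List.take_append_drop]

/-- Cutting a cycle at two edges and reversing one of the parts replaces these edges. -/
theorem cycSum_reverse_append [AddCommMonoid M] (g : α → α → M) (hg : ∀ x y, g x y = g y x)
    (p q r s : α) (a b : List α) (ha : a.head? = some q) (ha' : a.getLast? = some r)
    (hb : b.head? = some s) (hb' : b.getLast? = some p) :
    ∃ c : M, cycSum g (a ++ b) = c + (g p q + g r s) ∧
      cycSum g (a.reverse ++ b) = c + (g p r + g q s) := by
  have split : ∀ (u v : List α) (x y x' y' : α), u.head? = some x → u.getLast? = some y →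
      v.head? = some x' → v.getLast? = some y' →
      cycSum g (u ++ v) = pathSum g u + pathSum g v + (g y x' + g y' x) := by
    have aux : ∀ (u : List α) (y z : α), u.getLast? = some y →
        pathSum g (u ++ [z]) = pathSum g u + g y z := by
      intro u y z hu
      obtain ⟨u', rfl⟩ : ∃ u', u = u' ++ [y] := by
        rw [List.getLast?_eq_some_iff] at hu
        exact hu
      rw [List.append_assoc, List.singleton_append, pathSum_append]
      simp [pathSum]
    intro u v x y x' y' h1 h2 h3 h4
    obtain ⟨u', rfl⟩ := List.head?_eq_some_iff.1 h1
    obtain ⟨v', rfl⟩ := List.head?_eq_some_iff.1 h3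
    rw [cycSum_append, aux _ _ _ h2, aux _ _ _ h4]
    abel
  refine ⟨pathSum g a + pathSum g b, ?_, ?_⟩
  · rw [split a b q r s p ha ha' hb hb', add_comm (g r s)]
  · rw [split a.reverse b r q s p (by simpa using ha') (by simpa using ha) hb hb',
      pathSum_reverse g hg, add_comm (g q s)]

end PathSums

/-! ### Crossings counted as sign changes -/

section SignChanges

variable {α β : Type*}

open Classical in
/-- `1` if exactly one of two points satisfies `P`, and `0` otherwise. -/
noncomputable def signFlip (P : α → Prop) (x y : α) : ℕ := if (P x ↔ P y) then 0 else 1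

theorem signFlip_comm (P : α → Prop) (x y : α) : signFlip P x y = signFlip P y x := by
  unfold signFlip
  split_ifs <;> first | rfl | tauto

theorem signFlip_le_one (P : α → Prop) (x y : α) : signFlip P x y ≤ 1 := by
  unfold signFlip; split_ifs <;> simp

theorem signFlip_self (P : α → Prop) (x : α) : signFlip P x x = 0 := by
  simp [signFlip]

theorem signFlip_triangle (P : α → Prop) (x y z : α) :
    signFlip P x z ≤ signFlip P x y + signFlip P y z := by
  unfold signFlip
  split_ifs <;> first | omega | tauto

/-- Shortcutting a walk adds no crossings, since `signFlip P` satisfies the triangle inequality. -/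
theorem pathSum_signFlip_le_of_sublist (P : α → Prop) {l₁ l₂ : List α} (h : l₁.Sublist l₂) :
    pathSum (signFlip P) l₁ ≤ pathSum (signFlip P) l₂ := by
  -- A common extra head turns the deletion of a first entry into an interior deletion, where the
  -- triangle inequality applies.
  have key : ∀ x, pathSum (signFlip P) (x :: l₁) ≤ pathSum (signFlip P) (x :: l₂) := by
    induction h with
    | slnil => exact fun x => le_rfl
    | @cons l₁ l₂ a _ ih =>
      refine fun x => (ih x).trans ?_
      cases l₂ with
      | nil => simp [pathSum]
      | cons b l =>
        simp only [pathSum]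
        have := signFlip_triangle P x a b
        omega
    | cons_cons a _ ih => exact fun x => by simpa only [pathSum] using Nat.add_le_add_left (ih a) _
  cases l₂ with
  | nil => rw [List.sublist_nil.1 h]
  | cons b l =>
    have := key b
    simp only [pathSum, signFlip_self, zero_add] at this
    refine le_trans ?_ this
    cases l₁ with
    | nil => exact Nat.zero_le _
    | cons c l => simp only [pathSum]; omega

theorem cycSum_signFlip_le (P : α → Prop) (l : List α) :
    cycSum (signFlip P) l ≤ pathSum (signFlip P) l + 1 := by
  cases l with
  | nil => simp [cycSum]
  | cons x l =>
    rw [cycSum]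
    rcases List.eq_nil_or_concat' (x :: l) with h | ⟨u, y, h⟩
    · simp at h
    · rw [h, List.append_assoc, List.singleton_append, pathSum_append]
      simpa [pathSum] using signFlip_le_one P y x

/-- Concatenating closed walks along a path of base points. -/
theorem pathSum_signFlip_flatMap (P : α → Prop) (W : β → List α) (r : β → α) (l : List β)
    (hhead : ∀ i ∈ l, (W i).head? = some (r i)) (hlast : ∀ i ∈ l, (W i).getLast? = some (r i)) :
    pathSum (signFlip P) (l.flatMap W) =
      (l.map fun i => pathSum (signFlip P) (W i)).sum + pathSum (signFlip P) (l.map r) := by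
  induction l with
  | nil => rfl
  | cons i l ih =>
    have ih := ih (fun j hj => hhead j (by simp [hj])) (fun j hj => hlast j (by simp [hj]))
    cases l with
    | nil => simp [pathSum]
    | cons j l =>
      obtain ⟨u, hu⟩ := List.getLast?_eq_some_iff.1 (hlast i (by simp))
      obtain ⟨v, hv⟩ := List.head?_eq_some_iff.1 (hhead j (by simp))
      have h1 : (i :: j :: l).flatMap W = u ++ r i :: (r j :: (v ++ l.flatMap W)) := by
        simp [hu, hv]
      have h2 : (j :: l).flatMap W = r j :: (v ++ l.flatMap W) := by simp [hv]
      rw [h1, pathSum_append, ← hu]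
      rw [h2] at ih
      simp only [pathSum, List.map_cons, List.sum_cons] at ih ⊢
      rw [ih]
      ring

end SignChanges

/-! ### Edge density of the unit distance graph of a set family -/

section UnitDistance

open Finset

variable {α : Type*} [DecidableEq α]

/-- Haussler's bound for the number of edges of the unit distance graph of a set family that
shatters no set with more than `d` elements. -/
theorem sum_card_unit_edges_le (X : Finset α) (𝒜 : Finset (Finset α)) (d : ℕ)
    (hX : ∀ S ∈ 𝒜, S ⊆ X) (hd : ∀ T, 𝒜.Shatters T → #T ≤ d) :
    ∑ x ∈ X, #{S ∈ 𝒜 | x ∉ S ∧ insert x S ∈ 𝒜} ≤ d * #𝒜 := by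
  induction X using Finset.induction_on generalizing 𝒜 d with
  | empty => simp
  | insert a X ha ih =>
    -- Project along `a`. The edges in direction `a` inject into `𝒜₀ ∩ 𝒜₁`; those in any other
    -- direction are distributed over the edges of `𝒜₀ ∪ 𝒜₁` and `𝒜₀ ∩ 𝒜₁`.
    set 𝒜₀ := 𝒜.nonMemberSubfamily a with h𝒜₀
    set 𝒜₁ := 𝒜.memberSubfamily a with h𝒜₁
    have hcard : #𝒜 = #(𝒜₀ ∪ 𝒜₁) + #(𝒜₀ ∩ 𝒜₁) := by
      rw [card_union_add_card_inter, add_comm, card_memberSubfamily_add_card_nonMemberSubfamily]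
    have ha₁ : #{S ∈ 𝒜 | a ∉ S ∧ insert a S ∈ 𝒜} ≤ #(𝒜₀ ∩ 𝒜₁) := by
      refine card_le_card fun S hS => ?_
      simp only [mem_filter, mem_inter, h𝒜₀, h𝒜₁, mem_nonMemberSubfamily,
        mem_memberSubfamily] at hS ⊢
      tauto
    have hsplit : ∀ x ∈ X, #{S ∈ 𝒜 | x ∉ S ∧ insert x S ∈ 𝒜} ≤
        #{S ∈ 𝒜₀ ∪ 𝒜₁ | x ∉ S ∧ insert x S ∈ 𝒜₀ ∪ 𝒜₁} +
          #{S ∈ 𝒜₀ ∩ 𝒜₁ | x ∉ S ∧ insert x S ∈ 𝒜₀ ∩ 𝒜₁} := by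
      intro x hx
      have hxa : a ≠ x := fun h => ha (h ▸ hx)
      rw [← card_memberSubfamily_add_card_nonMemberSubfamily a {S ∈ 𝒜 | x ∉ S ∧ insert x S ∈ 𝒜},
        ← card_union_add_card_inter]
      refine Nat.add_le_add (card_le_card fun S hS => ?_) (card_le_card fun S hS => ?_)
      · simp only [mem_union, mem_memberSubfamily, mem_nonMemberSubfamily, mem_filter, mem_insert,
          h𝒜₀, h𝒜₁, insert_comm x a S] at hS ⊢
        tauto
      · simp only [mem_inter, mem_memberSubfamily, mem_nonMemberSubfamily, mem_filter, mem_insert,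
          h𝒜₀, h𝒜₁, insert_comm x a S] at hS ⊢
        tauto
    have hsub : ∀ S, S ∈ 𝒜₀ ∨ S ∈ 𝒜₁ → a ∉ S ∧ S ⊆ X := by
      intro S hS
      have haS : a ∉ S := by
        rcases hS with h | h
        · exact (mem_nonMemberSubfamily.1 h).2
        · exact (mem_memberSubfamily.1 h).2
      refine ⟨haS, ?_⟩
      rcases hS with h | h
      · exact (subset_insert_iff_of_notMem haS).1 (hX S (mem_nonMemberSubfamily.1 h).1)
      · exact (subset_insert_iff_of_notMem haS).1
          ((subset_insert a S).trans (hX _ (mem_memberSubfamily.1 h).1))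
    have h₁ : ∑ x ∈ X, #{S ∈ 𝒜₀ ∪ 𝒜₁ | x ∉ S ∧ insert x S ∈ 𝒜₀ ∪ 𝒜₁} ≤ d * #(𝒜₀ ∪ 𝒜₁) := by
      refine ih _ d (fun S hS => (hsub S (mem_union.1 hS)).2) fun T hT => hd T fun U hU => ?_
      obtain ⟨V, hV, hVT⟩ := hT.exists_superset
      have haT : a ∉ T := fun h => (hsub V (mem_union.1 hV)).1 (hVT h)
      obtain ⟨S, hS, rfl⟩ := hT hU
      rcases mem_union.1 hS with h | h
      · exact ⟨S, (mem_nonMemberSubfamily.1 h).1, rfl⟩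
      · exact ⟨insert a S, (mem_memberSubfamily.1 h).1, inter_insert_of_notMem haT⟩
    have h₂ : ∑ x ∈ X, #{S ∈ 𝒜₀ ∩ 𝒜₁ | x ∉ S ∧ insert x S ∈ 𝒜₀ ∩ 𝒜₁} + #(𝒜₀ ∩ 𝒜₁) ≤
        d * #(𝒜₀ ∩ 𝒜₁) := by
      -- A set shattered by the intersection stays shattered by `𝒜` after adding `a`. This drop in
      -- dimension pays for the edges in direction `a`.
      have hT' : ∀ T, (𝒜₀ ∩ 𝒜₁).Shatters T → #T + 1 ≤ d := by
        intro T hT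
        obtain ⟨V, hV, hVT⟩ := hT.exists_superset
        have haT : a ∉ T := fun h => (hsub V (Or.inl (mem_inter.1 hV).1)).1 (hVT h)
        rw [← card_insert_of_notMem haT]
        refine hd _ fun U hU => ?_
        rw [subset_insert_iff] at hU
        obtain ⟨S, hS, hSU⟩ := hT hU
        have hS0 := mem_nonMemberSubfamily.1 (mem_inter.1 hS).1
        have hS1 := mem_memberSubfamily.1 (mem_inter.1 hS).2
        by_cases haU : a ∈ U
        · exact ⟨insert a S, hS1.1, by rw [← insert_inter_distrib, hSU, insert_erase haU]⟩
        · exact ⟨S, hS0.1, by rw [insert_inter_of_notMem hS0.2, hSU, erase_eq_self.2 haU]⟩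
      rcases (𝒜₀ ∩ 𝒜₁).eq_empty_or_nonempty with h | h
      · simp [h]
      · obtain ⟨e, rfl⟩ : ∃ e, d = e + 1 := by
          have := hT' ∅ (shatters_empty.2 h)
          exact ⟨d - 1, by omega⟩
        have := ih (𝒜₀ ∩ 𝒜₁) e (fun S hS => (hsub S (Or.inl (mem_inter.1 hS).1)).2)
          fun T hT => by have := hT' T hT; omega
        rw [add_mul, one_mul]
        omega
    rw [sum_insert ha, hcard, mul_add]
    have := sum_le_sum hsplit
    rw [sum_add_distrib] at this
    omega

/-- Weighted form of the bound for the unit distance graph. -/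
theorem sum_min_unit_edges_le [Fintype α] (w : Finset α → ℕ) (d : ℕ)
    (hd : ∀ T, ({S | w S ≠ 0} : Finset (Finset α)).Shatters T → #T ≤ d) :
    ∑ x, ∑ S, (if x ∉ S then min (w S) (w (insert x S)) else 0) ≤ d * ∑ S, w S := by
  set N := ∑ S, w S with hN
  have hle : ∀ S, w S ≤ N := fun S => single_le_sum (fun _ _ => Nat.zero_le _) (mem_univ S)
  -- Layer-cake decomposition: the unweighted bound is applied to each superlevel family `{S | t < w
  -- S}`, which lies in the support of `w`.
  have hlayer : ∀ k ≤ N, k = ∑ t ∈ range N, if t < k then 1 else 0 := by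
    intro k hk
    rw [← sum_filter, sum_const, smul_eq_mul, mul_one]
    have : {t ∈ range N | t < k} = range k := by
      ext t; simp only [mem_filter, mem_range]; omega
    rw [this, card_range]
  calc ∑ x, ∑ S, (if x ∉ S then min (w S) (w (insert x S)) else 0)
      = ∑ x, ∑ S, ∑ t ∈ range N,
          if t < w S ∧ x ∉ S ∧ t < w (insert x S) then 1 else 0 := by
        refine sum_congr rfl fun x _ => sum_congr rfl fun S _ => ?_
        by_cases hx : x ∈ S
        · simp [hx]
        · rw [if_pos hx, hlayer (min (w S) (w (insert x S))) ((min_le_left _ _).trans (hle S))]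
          simp [hx]
    _ = ∑ t ∈ range N, ∑ x, #{S ∈ ({S | t < w S} : Finset (Finset α)) |
          x ∉ S ∧ insert x S ∈ ({S | t < w S} : Finset (Finset α))} := by
        rw [(sum_congr rfl fun x _ => sum_comm).trans sum_comm]
        refine sum_congr rfl fun t _ => sum_congr rfl fun x _ => ?_
        rw [filter_filter, card_filter]
        simp
    _ ≤ ∑ t ∈ range N, d * #({S | t < w S} : Finset (Finset α)) := by
        refine sum_le_sum fun t _ => sum_card_unit_edges_le univ _ d (fun S _ => subset_univ S) ?_
        refine fun T hT => hd T (hT.mono_left fun S hS => ?_)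
        simp only [mem_filter, mem_univ, true_and] at hS ⊢
        omega
    _ = d * ∑ S, w S := by
        rw [← mul_sum]
        congr 1
        simp_rw [card_filter]
        rw [sum_comm]
        exact sum_congr rfl fun S _ => (hlayer _ (hle S)).symm

end UnitDistance

/-! ### Haussler's packing bound -/

section Packing

open Finset Classical

variable {ι H : Type*}

/-- No three elements of `H` take all eight sign patterns on `P`. -/
def NoShatteredTriple (pos : H → ι → Prop) (P : Finset ι) : Prop :=
  ∀ h₁ h₂ h₃ : H, ∃ b₁ b₂ b₃ : Prop, ∀ p ∈ P,
    ¬ ((pos h₁ p ↔ b₁) ∧ (pos h₂ p ↔ b₂) ∧ (pos h₃ p ↔ b₃))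

/-- The indices of those entries of a sample that are positive at `p`. -/
noncomputable def signTrace {t : ℕ} (pos : H → ι → Prop) (a : Fin t → H) (p : ι) :
    Finset (Fin t) := {i | pos (a i) p}

/-- A shattered triple of sample indices would show all eight sign patterns of the three sampled
elements on `P`. -/
theorem card_le_two_of_shatters {t : ℕ} {pos : H → ι → Prop} {P : Finset ι}
    (hP : NoShatteredTriple pos P) (a : Fin t → H) (T : Finset (Fin t))
    (hT : (P.image (signTrace pos a)).Shatters T) : #T ≤ 2 := by
  by_contra! h
  obtain ⟨T', hT', h3⟩ := exists_subset_card_eq (show 3 ≤ #T from h)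
  obtain ⟨i, j, k, hij, hik, hjk, rfl⟩ := card_eq_three.1 h3
  obtain ⟨b₁, b₂, b₃, hb⟩ := hP (a i) (a j) (a k)
  obtain ⟨U, hU, hTU⟩ := (hT.mono_right hT') (filter_subset (fun l =>
    (l = i ∧ b₁) ∨ (l = j ∧ b₂) ∨ (l = k ∧ b₃)) _)
  obtain ⟨p, hp, rfl⟩ := mem_image.1 hU
  refine hb p hp ⟨?_, ?_, ?_⟩
  · simpa [signTrace, hij, hik] using Finset.ext_iff.1 hTU i
  · simpa [signTrace, hij.symm, hjk] using Finset.ext_iff.1 hTU j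
  · simpa [signTrace, hik.symm, hjk.symm] using Finset.ext_iff.1 hTU k

/-- Sauer–Shelah in dimension two gives `1 + t + t(t-1)/2` traces. -/
theorem card_image_signTrace_le {t : ℕ} {pos : H → ι → Prop} {P : Finset ι}
    (hP : NoShatteredTriple pos P) (a : Fin t → H) :
    #(P.image (signTrace pos a)) ≤ t ^ 2 + 1 := by
  refine (card_le_card_shatterer _).trans (card_shatterer_le_sum_vcDim.trans ?_)
  have hd : (P.image (signTrace pos a)).vcDim ≤ 2 :=
    Finset.sup_le fun T hT => card_le_two_of_shatters hP a T (mem_shatterer.1 hT)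
  calc _ ≤ ∑ k ∈ Iic 2, (Fintype.card (Fin t)).choose k :=
        sum_le_sum_of_subset (Iic_subset_Iic.2 hd)
    _ = t.choose 0 + t.choose 1 + t.choose 2 := by
        rw [Fintype.card_fin, show (Iic 2 : Finset ℕ) = range 3 from rfl, sum_range_succ,
          sum_range_succ, sum_range_one]
    _ ≤ t ^ 2 + 1 := by
        rw [Nat.choose_zero_right, Nat.choose_one_right, Nat.choose_two_right]
        cases t with
        | zero => simp
        | succ n =>
          have := Nat.div_mul_le_self ((n + 1) * (n + 1 - 1)) 2
          simp only [Nat.add_sub_cancel] at this ⊢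
          nlinarith

/-- The number of points of `P` with a given trace. -/
noncomputable def traceWeight {t : ℕ} (pos : H → ι → Prop) (P : Finset ι) (a : Fin t → H)
    (S : Finset (Fin t)) : ℕ := #{p ∈ P | signTrace pos a p = S}

/-- The total weight of the unit distance edges in direction `i` of a sample. -/
noncomputable def splitWeight {t : ℕ} (pos : H → ι → Prop) (P : Finset ι) (a : Fin t → H)
    (i : Fin t) : ℕ :=
  ∑ S, if i ∉ S then min (traceWeight pos P a S) (traceWeight pos P a (insert i S)) else 0

theorem sum_splitWeight_le {t : ℕ} {pos : H → ι → Prop} {P : Finset ι}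
    (hP : NoShatteredTriple pos P) (a : Fin t → H) :
    ∑ i, splitWeight pos P a i ≤ 2 * #P := by
  have h := sum_min_unit_edges_le (traceWeight pos P a) 2 fun T hT =>
    card_le_two_of_shatters hP a T (hT.mono_left fun S hS => ?_)
  · refine h.trans_eq ?_
    rw [card_eq_sum_card_fiberwise (f := signTrace pos a) (t := univ) (fun _ _ => mem_coe.2 (mem_univ _))]
    rfl
  · simp only [traceWeight, mem_filter, mem_univ, true_and, ne_eq, card_eq_zero] at hS
    obtain ⟨p, hp⟩ := nonempty_iff_ne_empty.2 hS
    exact mem_image.2 ⟨p, (mem_filter.1 hp).1, (mem_filter.1 hp).2⟩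

variable [Fintype H]

/-- A class of `b` points, any two of which are separated by weight at least `δ`, is split evenly
enough by a random element of `H`. -/
theorem le_sum_mul_min (pos : H → ι → Prop) (C : Finset ι) (μ : H → ℝ) (hμ : ∀ h, 0 ≤ μ h)
    (δ : ℝ) (hC : C.Nonempty)
    (hδ : ∀ p ∈ C, ∀ q ∈ C, p ≠ q → δ ≤ ∑ h, μ h * signFlip (pos h) p q) :
    δ / 2 * ((#C : ℝ) - 1) ≤
      ∑ h, μ h * (min #{p ∈ C | ¬ pos h p} #{p ∈ C | pos h p} : ℕ) := by
  have hb : (0 : ℝ) < #C := by exact_mod_cast hC.card_pos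
  -- Double counting of separated ordered pairs. If `h` splits `C` into parts of sizes `x` and `y`,
  -- there are `2xy ≤ 2 * #C * min x y` of them, while the hypothesis bounds their weighted count
  -- below by `δ * #C * (#C - 1)`.
  have h1 : ∀ h, ∑ p ∈ C, ∑ q ∈ C, (signFlip (pos h) p q : ℝ) ≤
      2 * #C * (min #{p ∈ C | ¬ pos h p} #{p ∈ C | pos h p} : ℕ) := by
    intro h
    have hcard : #{p ∈ C | pos h p} + #{p ∈ C | ¬ pos h p} = #C :=
      card_filter_add_card_filter_not _
    have h2 : ∑ p ∈ C, ∑ q ∈ C, signFlip (pos h) p q =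
        2 * (#{p ∈ C | pos h p} * #{p ∈ C | ¬ pos h p}) := by
      have : ∀ p ∈ C, ∑ q ∈ C, signFlip (pos h) p q =
          if pos h p then #{p ∈ C | ¬ pos h p} else #{p ∈ C | pos h p} := by
        intro p _
        split_ifs with hp
        · rw [card_filter]
          exact sum_congr rfl fun q _ => by by_cases hq : pos h q <;> simp [signFlip, hp, hq]
        · rw [card_filter]
          exact sum_congr rfl fun q _ => by by_cases hq : pos h q <;> simp [signFlip, hp, hq]
      rw [sum_congr rfl this, sum_ite]
      simp only [sum_const, smul_eq_mul]
      ring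
    have h3 : ∑ p ∈ C, ∑ q ∈ C, signFlip (pos h) p q ≤
        2 * #C * min #{p ∈ C | ¬ pos h p} #{p ∈ C | pos h p} := by
      rw [h2, ← hcard]
      rcases le_total #{p ∈ C | ¬ pos h p} #{p ∈ C | pos h p} with hle | hle
      · rw [min_eq_left hle]; nlinarith
      · rw [min_eq_right hle]; nlinarith
    exact_mod_cast h3
  have h4 : δ * (#C * (#C - 1)) ≤ ∑ p ∈ C, ∑ q ∈ C, ∑ h, μ h * signFlip (pos h) p q := by
    calc δ * (#C * (#C - 1)) = ∑ p ∈ C, ∑ q ∈ C.erase p, δ := by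
          rw [sum_congr rfl fun p hp => by rw [sum_const, card_erase_of_mem hp]]
          rw [sum_const, nsmul_eq_mul, nsmul_eq_mul, Nat.cast_pred hC.card_pos]
          ring
      _ ≤ ∑ p ∈ C, ∑ q ∈ C.erase p, ∑ h, μ h * signFlip (pos h) p q :=
          sum_le_sum fun p hp => sum_le_sum fun q hq =>
            hδ p hp q (mem_of_mem_erase hq) (ne_of_mem_erase hq).symm
      _ ≤ _ := sum_le_sum fun p hp => sum_le_sum_of_subset_of_nonneg (erase_subset _ _)
            fun q _ _ => sum_nonneg fun h _ => mul_nonneg (hμ h) (Nat.cast_nonneg _)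
  have h5 : ∑ p ∈ C, ∑ q ∈ C, ∑ h, μ h * signFlip (pos h) p q ≤
      2 * #C * ∑ h, μ h * (min #{p ∈ C | ¬ pos h p} #{p ∈ C | pos h p} : ℕ) := by
    calc _ = ∑ h, μ h * ∑ p ∈ C, ∑ q ∈ C, (signFlip (pos h) p q : ℝ) := by
          rw [(sum_congr rfl fun p _ => sum_comm).trans sum_comm]
          simp_rw [mul_sum]
      _ ≤ ∑ h, μ h * (2 * #C * (min #{p ∈ C | ¬ pos h p} #{p ∈ C | pos h p} : ℕ)) :=
          sum_le_sum fun h _ => mul_le_mul_of_nonneg_left (h1 h) (hμ h)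
      _ = _ := by rw [mul_sum]; exact sum_congr rfl fun h _ => by ring
  have h6 := h4.trans h5
  refine le_of_mul_le_mul_left ?_ (show (0 : ℝ) < 2 * #C by positivity)
  linarith

/-- With the other `s` entries fixed, `P` falls into at most `s ^ 2 + 1` trace classes. A new entry
at position `i` splits each class along one edge in direction `i`, so `le_sum_mul_min` applies class
by class, and each class loses one in the count. -/
theorem le_sum_splitWeight_insertNth {s : ℕ} {pos : H → ι → Prop} {P : Finset ι}
    (hP : NoShatteredTriple pos P) (μ : H → ℝ) (hμ : ∀ h, 0 ≤ μ h) (δ : ℝ) (hδ0 : 0 ≤ δ)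
    (hδ : ∀ p ∈ P, ∀ q ∈ P, p ≠ q → δ ≤ ∑ h, μ h * signFlip (pos h) p q)
    (i : Fin (s + 1)) (a : Fin s → H) :
    δ / 2 * ((#P : ℝ) - (s ^ 2 + 1)) ≤
      ∑ h, μ h * splitWeight pos P (Fin.insertNth i h a : Fin (s + 1) → H) i := by
  set K := P.image (signTrace pos a) with hK
  let e := Fin.succAboveEmb i
  have hi : ∀ Q : Finset (Fin s), i ∉ Q.map e := by
    intro Q h
    obtain ⟨j, _, hj⟩ := mem_map.1 h
    exact Fin.succAbove_ne i j hj
  have htr : ∀ (h : H) (p : ι), signTrace pos (Fin.insertNth i h a : Fin (s + 1) → H) p =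
      if pos h p then insert i ((signTrace pos a p).map e)
      else (signTrace pos a p).map e := by
    intro h p
    ext j
    have hself := hi (signTrace pos a p)
    refine Fin.succAboveCases i ?_ (fun j => ?_) j
    · by_cases hp : pos h p <;> simp [signTrace, hp, e]
    · have : i.succAbove j ∈ (signTrace pos a p).map e ↔ pos (a j) p := by
        change e j ∈ _ ↔ _
        rw [mem_map']
        simp [signTrace]
      by_cases hp : pos h p
      · rw [if_pos hp, mem_insert, this]
        simp [signTrace, Fin.succAbove_ne]
      · rw [if_neg hp, this]
        simp [signTrace]
  have hinj : ∀ Q Q' : Finset (Fin s), Q.map e = Q'.map e ↔ Q = Q' :=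
    fun Q Q' => map_inj
  have hins : ∀ Q Q' : Finset (Fin s),
      insert i (Q.map e) = insert i (Q'.map e) ↔ Q = Q' := by
    intro Q Q'
    refine ⟨fun h => ?_, fun h => by rw [h]⟩
    rw [← hinj, ← erase_insert (hi Q), h, erase_insert (hi Q')]
  have hne : ∀ Q Q' : Finset (Fin s), insert i (Q.map e) ≠ Q'.map e :=
    fun Q Q' h => hi Q' (h ▸ mem_insert_self _ _)
  have hw : ∀ (h : H) (Q : Finset (Fin s)),
      min #{p ∈ {p ∈ P | signTrace pos a p = Q} | ¬ pos h p}
        #{p ∈ {p ∈ P | signTrace pos a p = Q} | pos h p} =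
      min (traceWeight pos P (Fin.insertNth i h a : Fin (s + 1) → H) (Q.map e))
        (traceWeight pos P (Fin.insertNth i h a : Fin (s + 1) → H)
          (insert i (Q.map e))) := by
    intro h Q
    unfold traceWeight
    rw [filter_filter, filter_filter]
    congr 2
    · refine filter_congr fun p _ => ?_
      rw [htr]
      split_ifs with hp
      · simp [hp, hne]
      · simp [hp, hinj]
    · refine filter_congr fun p _ => ?_
      rw [htr]
      split_ifs with hp
      · simp [hp, hins]
      · simp [hp, (hne _ _).symm]
  have hge : ∀ h, ∑ Q ∈ K, min #{p ∈ {p ∈ P | signTrace pos a p = Q} | ¬ pos h p}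
        #{p ∈ {p ∈ P | signTrace pos a p = Q} | pos h p} ≤
      splitWeight pos P (Fin.insertNth i h a : Fin (s + 1) → H) i := by
    intro h
    unfold splitWeight
    calc _ = ∑ S ∈ K.map ⟨fun Q : Finset (Fin s) => Q.map e,
            fun Q Q' hQ => (hinj Q Q').1 hQ⟩,
          (if i ∉ S then min (traceWeight pos P (Fin.insertNth i h a : Fin (s + 1) → H) S)
            (traceWeight pos P (Fin.insertNth i h a : Fin (s + 1) → H) (insert i S)) else 0) := by
          rw [sum_map]
          refine sum_congr rfl fun Q _ => ?_
          rw [hw]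
          exact (if_pos (hi Q)).symm
      _ ≤ _ := sum_le_sum_of_subset (subset_univ _)
  have hcl : ∀ Q ∈ K, δ / 2 * ((#{p ∈ P | signTrace pos a p = Q} : ℝ) - 1) ≤
      ∑ h, μ h * (min #{p ∈ {p ∈ P | signTrace pos a p = Q} | ¬ pos h p}
        #{p ∈ {p ∈ P | signTrace pos a p = Q} | pos h p} : ℕ) := by
    intro Q hQ
    refine le_sum_mul_min pos _ μ hμ δ ?_ fun p hp q hq => hδ p (filter_subset _ _ hp) q
      (filter_subset _ _ hq)
    obtain ⟨p, hp, hpQ⟩ := mem_image.1 hQ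
    exact ⟨p, mem_filter.2 ⟨hp, hpQ⟩⟩
  have hcardP : (#P : ℝ) = ∑ Q ∈ K, (#{p ∈ P | signTrace pos a p = Q} : ℝ) := by
    exact_mod_cast card_eq_sum_card_image (signTrace pos a) P
  have hcardK : (#K : ℝ) ≤ s ^ 2 + 1 := by exact_mod_cast card_image_signTrace_le hP a
  calc δ / 2 * ((#P : ℝ) - (s ^ 2 + 1)) ≤ δ / 2 * ((#P : ℝ) - #K) := by gcongr
    _ = ∑ Q ∈ K, δ / 2 * ((#{p ∈ P | signTrace pos a p = Q} : ℝ) - 1) := by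
        rw [← mul_sum, sum_sub_distrib, ← hcardP]
        simp
    _ ≤ _ := sum_le_sum hcl
    _ = ∑ h, μ h * (∑ Q ∈ K, min #{p ∈ {p ∈ P | signTrace pos a p = Q} | ¬ pos h p}
        #{p ∈ {p ∈ P | signTrace pos a p = Q} | pos h p} : ℕ) := by
        rw [sum_comm]
        refine sum_congr rfl fun h _ => ?_
        rw [Nat.cast_sum, mul_sum]
    _ ≤ _ := sum_le_sum fun h _ => mul_le_mul_of_nonneg_left (by exact_mod_cast hge h) (hμ h)

/-- Draw `s + 1` independent elements of `H` from `μ` and compute the expected total split weight in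
two ways: every sample gives at most `2 * #P`, and every single direction contributes at least the
bound of `le_sum_splitWeight_insertNth`. -/
theorem packing_aux {pos : H → ι → Prop} {P : Finset ι}
    (hP : NoShatteredTriple pos P) (μ : H → ℝ) (hμ : ∀ h, 0 ≤ μ h) (hμ1 : ∑ h, μ h = 1)
    (δ : ℝ) (hδ0 : 0 ≤ δ)
    (hδ : ∀ p ∈ P, ∀ q ∈ P, p ≠ q → δ ≤ ∑ h, μ h * signFlip (pos h) p q) (s : ℕ) :
    (s + 1) * (δ / 2 * ((#P : ℝ) - (s ^ 2 + 1))) ≤ 2 * #P := by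
  have htot : ∀ n : ℕ, ∑ a : Fin n → H, ∏ j, μ (a j) = 1 := by
    intro n
    rw [← Fintype.piFinset_univ, ← prod_univ_sum]
    simp [hμ1]
  have hup : ∑ a : Fin (s + 1) → H, (∏ j, μ (a j)) * ∑ i, (splitWeight pos P a i : ℝ) ≤
      2 * #P := by
    calc _ ≤ ∑ a : Fin (s + 1) → H, (∏ j, μ (a j)) * (2 * #P) :=
          sum_le_sum fun a _ => mul_le_mul_of_nonneg_left
            (by exact_mod_cast sum_splitWeight_le hP a) (prod_nonneg fun j _ => hμ _)
      _ = _ := by rw [← sum_mul, htot, one_mul]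
  refine le_trans ?_ hup
  simp_rw [mul_sum]
  rw [sum_comm]
  have hlow : ∀ i : Fin (s + 1), δ / 2 * ((#P : ℝ) - (s ^ 2 + 1)) ≤
      ∑ a : Fin (s + 1) → H, (∏ j, μ (a j)) * (splitWeight pos P a i : ℝ) := by
    intro i
    -- Fubini: the coordinate `i` is averaged with the others held fixed.
    rw [← (Fin.insertNthEquiv (fun _ => H) i).sum_comp, Fintype.sum_prod_type, sum_comm]
    calc _ = ∑ a : Fin s → H, (∏ j, μ (a j)) * (δ / 2 * ((#P : ℝ) - (s ^ 2 + 1))) := by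
          rw [← sum_mul, htot, one_mul]
      _ ≤ ∑ a : Fin s → H, (∏ j, μ (a j)) *
          ∑ h, μ h * splitWeight pos P (Fin.insertNth i h a : Fin (s + 1) → H) i :=
          sum_le_sum fun a _ => mul_le_mul_of_nonneg_left
            (le_sum_splitWeight_insertNth hP μ hμ δ hδ0 hδ i a) (prod_nonneg fun j _ => hμ _)
      _ = _ := by
          refine sum_congr rfl fun a _ => ?_
          rw [mul_sum]
          refine sum_congr rfl fun h _ => ?_
          rw [Fin.prod_univ_succAbove _ i]
          simp [Fin.insertNthEquiv]
          ring
  calc _ = ∑ _i : Fin (s + 1), δ / 2 * ((#P : ℝ) - (s ^ 2 + 1)) := by simp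
    _ ≤ _ := sum_le_sum fun i _ => hlow i

end Packing

/-! ### Welzl's paths of low stabbing number -/

section LowStabbing

open Finset Classical

/-- Otherwise the normalized weights separate every pair by at least `16 / √n`, where `n` is the
number of points, and `packing_aux` with `s` about `√n / 2` fails. -/
theorem exists_lightly_separated_pair {ι H : Type*} [Fintype H] {pos : H → ι → Prop}
    {P : Finset ι} (hP : NoShatteredTriple pos P) (hcard : 2 ≤ #P) (w : H → ℝ)
    (hw : ∀ h, 0 ≤ w h) :
    ∃ p ∈ P, ∃ q ∈ P, p ≠ q ∧
      ∑ h, w h * signFlip (pos h) p q ≤ 16 / √(#P : ℝ) * ∑ h, w h := by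
  by_contra! hcon
  have hn : (2 : ℝ) ≤ #P := by exact_mod_cast hcard
  obtain ⟨p, hp, q, hq, hpq⟩ := one_lt_card.1 (show 1 < #P by omega)
  set W := ∑ h, w h with hW
  set r := √(#P : ℝ) with hr
  have hr0 : 0 < r := Real.sqrt_pos.2 (by linarith)
  have hrr : r * r = #P := Real.mul_self_sqrt (by linarith)
  have hle : ∑ h, w h * signFlip (pos h) p q ≤ W :=
    sum_le_sum fun h _ => mul_le_of_le_one_right (hw h)
      (by exact_mod_cast signFlip_le_one (pos h) p q)
  have hlt := (hcon p hp q hq hpq).trans_le hle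
  have hW0 : 0 < W := by
    rcases (sum_nonneg fun h _ => hw h : 0 ≤ W).eq_or_lt with h | h
    · rw [← hW] at h; rw [← h] at hlt; simp at hlt
    · exact h
  -- No pair is separated by more than the whole weight, so a counterexample needs `r > 16`; this
  -- makes the term `s ^ 2 + 1` at most half of `r * r`.
  have hδ1 : 16 / r < 1 := by
    by_contra! h
    nlinarith
  have hr16 : 16 < r := by rwa [div_lt_one hr0] at hδ1
  have key := packing_aux hP (fun h => w h / W) (fun h => div_nonneg (hw h) hW0.le)
    (by rw [← sum_div, ← hW, div_self hW0.ne']) (16 / r) (by positivity)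
    (fun p hp q hq hpq => by
      have h1 : ∑ h, w h / W * signFlip (pos h) p q = (∑ h, w h * signFlip (pos h) p q) / W := by
        rw [sum_div]
        exact sum_congr rfl fun h _ => by ring
      rw [h1, le_div_iff₀ hW0]
      exact (hcon p hp q hq hpq).le) ⌊r / 2⌋₊
  have h1 : (⌊r / 2⌋₊ : ℝ) ≤ r / 2 := Nat.floor_le (by positivity)
  have h2 : r / 2 < ⌊r / 2⌋₊ + 1 := Nat.lt_floor_add_one _
  set s : ℝ := (⌊r / 2⌋₊ : ℝ)
  have hs0 : 0 ≤ s := Nat.cast_nonneg _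
  rw [← hrr] at key
  have h3 : r * r / 2 ≤ r * r - (s ^ 2 + 1) := by nlinarith
  have h4 : r / 2 * (16 / r / 2 * (r * r / 2)) < (s + 1) * (16 / r / 2 * (r * r - (s ^ 2 + 1))) := by
    have : 0 < 16 / r / 2 * (r * r / 2) := by positivity
    calc _ < (s + 1) * (16 / r / 2 * (r * r / 2)) := by gcongr
      _ ≤ _ := by gcongr
  have h5 : r / 2 * (16 / r / 2 * (r * r / 2)) = 2 * (r * r) := by field_simp; norm_num
  linarith

/-- One step of bounding the product of the factors `1 + 48 / √k` by an exponential: `√(n+1) - √n ≥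
1 / (2√(n+1))` makes the exponents telescope. -/
theorem one_add_div_sqrt_mul_exp_le (n : ℕ) :
    (1 + 48 / √((n : ℝ) + 1)) * Real.exp (96 * √(n : ℝ)) ≤ Real.exp (96 * √((n : ℝ) + 1)) := by
  have hb : 0 < √((n : ℝ) + 1) := Real.sqrt_pos.2 (by positivity)
  have hbb : √((n : ℝ) + 1) * √((n : ℝ) + 1) = n + 1 := Real.mul_self_sqrt (by positivity)
  have haa : √(n : ℝ) * √(n : ℝ) = n := Real.mul_self_sqrt (by positivity)
  have h1 : 48 / √((n : ℝ) + 1) ≤ 96 * √((n : ℝ) + 1) - 96 * √(n : ℝ) := by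
    rw [div_le_iff₀ hb]
    nlinarith [sq_nonneg (√((n : ℝ) + 1) - √(n : ℝ))]
  calc _ ≤ Real.exp (48 / √((n : ℝ) + 1)) * Real.exp (96 * √(n : ℝ)) := by
        gcongr
        rw [add_comm]
        exact Real.add_one_le_exp _
    _ = Real.exp (48 / √((n : ℝ) + 1) + 96 * √(n : ℝ)) := (Real.exp_add _ _).symm
    _ ≤ _ := Real.exp_le_exp.2 (by linarith)

/-- Inserting a detour `q → p → q` into a walk. -/
theorem pathSum_signFlip_insert_detour {α : Type*} (P : α → Prop) (p q : α) (u v : List α) :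
    pathSum (signFlip P) (u ++ q :: p :: q :: v) =
      pathSum (signFlip P) (u ++ q :: v) + 2 * signFlip P p q := by
  rw [pathSum_append, pathSum_append _ u q v]
  simp only [pathSum, signFlip_comm P q p]
  ring

/-- Welzl's theorem on spanning paths of low stabbing number, in its weighted form. -/
theorem exists_walk_weighted {ι H : Type*} [Fintype H] (pos : H → ι → Prop) (n : ℕ) :
    ∀ P : Finset ι, #P = n + 1 → NoShatteredTriple pos P → ∀ w : H → ℝ, (∀ h, 0 ≤ w h) →
    ∃ l : List ι, (∀ x, x ∈ l ↔ x ∈ P) ∧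
      ∑ h, w h * 2 ^ pathSum (signFlip (pos h)) l ≤ (∑ h, w h) * Real.exp (96 * √((n : ℝ) + 1)) := by
  induction n with
  | zero =>
    intro P hP _ w hw
    obtain ⟨x, rfl⟩ := card_eq_one.1 hP
    refine ⟨[x], by simp, ?_⟩
    simp only [pathSum, pow_zero, mul_one]
    exact le_mul_of_one_le_right (sum_nonneg fun h _ => hw h) (Real.one_le_exp (by positivity))
  | succ n ih =>
    intro P hP hsh w hw
    obtain ⟨p, hp, q, hq, hpq, hsep⟩ := exists_lightly_separated_pair hsh (by omega) w hw
    obtain ⟨l, hl, hsum⟩ := ih (P.erase p) (by rw [card_erase_of_mem hp]; omega)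
      (fun h₁ h₂ h₃ => by
        obtain ⟨b₁, b₂, b₃, hb⟩ := hsh h₁ h₂ h₃
        exact ⟨b₁, b₂, b₃, fun x hx => hb x (mem_of_mem_erase hx)⟩)
      -- The detour `q → p → q` costs two flips for each `h` that separates the pair, hence a factor
      -- `2 ^ 2`. Charging it in advance lets the induction hypothesis account for it.
      (fun h => w h * 4 ^ signFlip (pos h) p q) (fun h => mul_nonneg (hw h) (by positivity))
    obtain ⟨u, v, rfl⟩ := List.append_of_mem ((hl q).2 (mem_erase.2 ⟨hpq.symm, hq⟩))
    refine ⟨u ++ q :: p :: q :: v, fun x => ?_, ?_⟩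
    · have := hl x
      simp only [List.mem_append, List.mem_cons, mem_erase] at this ⊢
      by_cases hx : x = p
      · simp [hx, hp]
      · rw [← this.trans (and_iff_right hx)]
        tauto
    · have h1 : ∀ h, w h * 2 ^ pathSum (signFlip (pos h)) (u ++ q :: p :: q :: v) =
          w h * 4 ^ signFlip (pos h) p q * 2 ^ pathSum (signFlip (pos h)) (u ++ q :: v) := by
        intro h
        rw [pathSum_signFlip_insert_detour, pow_add, pow_mul]
        norm_num
        ring
      have h2 : ∑ h, w h * 4 ^ signFlip (pos h) p q ≤
          (1 + 48 / √(((n + 1 : ℕ) : ℝ) + 1)) * ∑ h, w h := by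
        -- As `signFlip` is `0` or `1`, `4 ^ f = 1 + 3 * f`; the constant 48 is `3 * 16`.
        have h3 : ∀ h, w h * 4 ^ signFlip (pos h) p q =
            w h + 3 * (w h * signFlip (pos h) p q) := by
          intro h
          have := signFlip_le_one (pos h) p q
          interval_cases signFlip (pos h) p q <;> norm_num
          ring
        have h4 : (#P : ℝ) = ((n + 1 : ℕ) : ℝ) + 1 := by rw [hP]; push_cast; ring
        rw [sum_congr rfl fun h _ => h3 h, sum_add_distrib, ← mul_sum, ← h4]
        calc _ ≤ ∑ h, w h + 3 * (16 / √(#P : ℝ) * ∑ h, w h) := by gcongr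
          _ = _ := by ring
      rw [sum_congr rfl fun h _ => h1 h]
      refine hsum.trans ?_
      calc _ ≤ ((1 + 48 / √(((n + 1 : ℕ) : ℝ) + 1)) * ∑ h, w h) *
            Real.exp (96 * √((n : ℝ) + 1)) := by gcongr
        _ = (∑ h, w h) * ((1 + 48 / √(((n + 1 : ℕ) : ℝ) + 1)) *
            Real.exp (96 * √((n + 1 : ℕ) : ℝ))) := by push_cast; ring
        _ ≤ _ := mul_le_mul_of_nonneg_left (one_add_div_sqrt_mul_exp_le (n + 1))
            (sum_nonneg fun h _ => hw h)

/-- The affine function `a x + b y - c` on the plane. -/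
def affineForm (a b c : ℝ) (p : Plane) : ℝ := a * p 0 + b * p 1 - c

theorem exists_ne_zero_mulVec_eq_zero {k n : ℕ} (hkn : k < n) (M : Matrix (Fin k) (Fin n) ℝ) :
    ∃ v : Fin n → ℝ, v ≠ 0 ∧ M.mulVec v = 0 := by
  have h : LinearMap.ker M.mulVecLin ≠ ⊥ := LinearMap.ker_ne_bot_of_finrank_lt (by simpa using hkn)
  obtain ⟨v, hv, hv0⟩ := (Submodule.ne_bot_iff _).1 h
  exact ⟨v, hv0, by simpa using hv⟩

/-- Three half-planes miss one of the eight cells. -/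
theorem exists_missing_sign_pattern (a b c : Fin 3 → ℝ) :
    ∃ s : Fin 3 → Prop, ∀ p, ¬ ∀ i, (0 < affineForm (a i) (b i) (c i) p ↔ s i) := by
  -- Three gradients in the plane are linearly dependent, so this combination of the three forms is
  -- constant. The pattern `0 < v i` would make it nonnegative and the pattern `v i < 0`
  -- nonpositive, one of them strictly.
  obtain ⟨v, hv0, hv⟩ := exists_ne_zero_mulVec_eq_zero (by norm_num) !![a 0, a 1, a 2; b 0, b 1, b 2]
  have ha : a 0 * v 0 + a 1 * v 1 + a 2 * v 2 = 0 := by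
    simpa [Matrix.mulVec, dotProduct, Fin.sum_univ_three] using congrFun hv 0
  have hb : b 0 * v 0 + b 1 * v 1 + b 2 * v 2 = 0 := by
    simpa [Matrix.mulVec, dotProduct, Fin.sum_univ_three] using congrFun hv 1
  have hconst : ∀ p, ∑ i, v i * affineForm (a i) (b i) (c i) p = -∑ i, v i * c i := by
    intro p
    simp only [affineForm, Fin.sum_univ_three]
    linear_combination p 0 * ha + p 1 * hb
  by_contra! hcon
  obtain ⟨p, hp⟩ := hcon fun i => 0 < v i
  obtain ⟨q, hq⟩ := hcon fun i => v i < 0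
  have h1 : ∀ i, 0 ≤ v i * affineForm (a i) (b i) (c i) p ∧
      (0 < v i → 0 < v i * affineForm (a i) (b i) (c i) p) := by
    intro i
    rcases lt_or_ge 0 (v i) with h | h
    · have := mul_pos h ((hp i).2 h)
      exact ⟨this.le, fun _ => this⟩
    · exact ⟨mul_nonneg_of_nonpos_of_nonpos h (not_lt.1 fun h' => not_lt.2 h ((hp i).1 h')),
        fun h' => absurd h' (not_lt.2 h)⟩
  have h2 : ∀ i, v i * affineForm (a i) (b i) (c i) q ≤ 0 ∧
      (v i < 0 → v i * affineForm (a i) (b i) (c i) q < 0) := by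
    intro i
    rcases lt_or_ge (v i) 0 with h | h
    · have := mul_neg_of_neg_of_pos h ((hq i).2 h)
      exact ⟨this.le, fun _ => this⟩
    · exact ⟨mul_nonpos_of_nonneg_of_nonpos h (not_lt.1 fun h' => not_lt.2 h ((hq i).1 h')),
        fun h' => absurd h' (not_lt.2 h)⟩
  obtain ⟨i, hi⟩ := Function.ne_iff.1 hv0
  have hp' := hconst p
  have hq' := hconst q
  have hp0 : 0 ≤ ∑ i, v i * affineForm (a i) (b i) (c i) p := sum_nonneg fun i _ => (h1 i).1
  have hq0 : ∑ i, v i * affineForm (a i) (b i) (c i) q ≤ 0 := sum_nonpos fun i _ => (h2 i).1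
  rcases lt_or_gt_of_ne hi with h | h
  · have : ∑ i, v i * affineForm (a i) (b i) (c i) q < 0 :=
      sum_neg' (fun i _ => (h2 i).1) ⟨i, mem_univ _, (h2 i).2 h⟩
    linarith
  · have : 0 < ∑ i, v i * affineForm (a i) (b i) (c i) p :=
      sum_pos' (fun i _ => (h1 i).1) ⟨i, mem_univ _, (h1 i).2 h⟩
    linarith

/-- Half-planes do not shatter four points. -/
theorem exists_missing_subset (r : Fin 4 → Plane) :
    ∃ s : Fin 4 → Prop, ∀ a b c, ¬ ∀ i, (0 < affineForm a b c (r i) ↔ s i) := by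
  -- An affine dependence of four points, as in Radon's theorem. A half-plane cutting out exactly
  -- the points with positive coefficient would make a vanishing sum positive.
  obtain ⟨v, hv0, hv⟩ := exists_ne_zero_mulVec_eq_zero (k := 3) (n := 4) (by norm_num)
    (Matrix.of ![fun i => r i 0, fun i => r i 1, fun _ => 1])
  have hx : ∑ i, r i 0 * v i = 0 := by
    simpa [Matrix.mulVec, dotProduct] using congrFun hv 0
  have hy : ∑ i, r i 1 * v i = 0 := by
    simpa [Matrix.mulVec, dotProduct] using congrFun hv 1
  have hz : ∑ i, v i = 0 := by
    simpa [Matrix.mulVec, dotProduct] using congrFun hv 2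
  have hzero : ∀ a b c, ∑ i, v i * affineForm a b c (r i) = 0 := by
    intro a b c
    simp only [affineForm, Fin.sum_univ_four] at hx hy hz ⊢
    linear_combination a * hx + b * hy - c * hz
  have hpos : ∃ u : Fin 4 → ℝ, (∃ i, 0 < u i) ∧
      ∀ a b c, ∑ i, u i * affineForm a b c (r i) = 0 := by
    obtain ⟨i, hi⟩ := Function.ne_iff.1 hv0
    rcases lt_or_gt_of_ne hi with h | h
    · refine ⟨-v, ⟨i, by simpa using h⟩, fun a b c => ?_⟩
      simpa using hzero a b c
    · exact ⟨v, ⟨i, h⟩, hzero⟩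
  obtain ⟨u, ⟨i, hi⟩, hu⟩ := hpos
  refine ⟨fun i => 0 < u i, fun a b c h => ?_⟩
  have h1 : ∀ i, 0 ≤ u i * affineForm a b c (r i) := by
    intro i
    rcases lt_or_ge 0 (u i) with h' | h'
    · exact (mul_pos h' ((h i).2 h')).le
    · exact mul_nonneg_of_nonpos_of_nonpos h' (not_lt.1 fun h'' => not_lt.2 h' ((h i).1 h''))
  have : 0 < ∑ i, u i * affineForm a b c (r i) :=
    sum_pos' (fun i _ => h1 i) ⟨i, mem_univ _, mul_pos hi ((h i).2 hi)⟩
  exact this.ne' (hu a b c)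

/-- The subfamily of a finite family of points cut out by half-planes. -/
noncomputable def halfPlaneTraces {ι : Type*} [Fintype ι] (r : ι → Plane) : Finset (Finset ι) :=
  {T | ∃ a b c, ∀ i, i ∈ T ↔ 0 < affineForm a b c (r i)}

theorem card_halfPlaneTraces_le {ι : Type*} [Fintype ι] (r : ι → Plane) :
    #(halfPlaneTraces r) ≤ (Fintype.card ι + 1) ^ 3 := by
  have hd : (halfPlaneTraces r).vcDim ≤ 3 := by
    refine Finset.sup_le fun T hT => ?_
    by_contra! h
    obtain ⟨T', hT', h4⟩ := exists_subset_card_eq (show 4 ≤ #T from h)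
    have hsh := (mem_shatterer.1 hT).mono_right hT'
    let e : Fin 4 ≃ T' := (T'.equivFinOfCardEq h4).symm
    obtain ⟨s, hs⟩ := exists_missing_subset fun i => r (e i)
    obtain ⟨U, hU, hTU⟩ := hsh (filter_subset (fun x => ∃ i, (e i : ι) = x ∧ s i) T')
    obtain ⟨a, b, c, habc⟩ := (mem_filter.1 hU).2
    refine hs a b c fun i => ?_
    rw [← habc]
    have := Finset.ext_iff.1 hTU (e i)
    simp only [mem_inter, (e i).2, true_and, mem_filter] at this
    rw [this]
    refine ⟨?_, fun h => ⟨i, rfl, h⟩⟩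
    rintro ⟨j, hj, hsj⟩
    rwa [← e.injective (Subtype.ext hj)]
  refine (card_le_card_shatterer _).trans (card_shatterer_le_sum_vcDim.trans ?_)
  set n := Fintype.card ι
  calc _ ≤ ∑ k ∈ Iic 3, n.choose k := sum_le_sum_of_subset (Iic_subset_Iic.2 hd)
    _ ≤ ∑ k ∈ range 4, n ^ k * (3 : ℕ).choose k := by
        rw [show (Iic 3 : Finset ℕ) = range 4 from rfl]
        refine sum_le_sum fun k hk => (Nat.choose_le_pow n k).trans ?_
        exact Nat.le_mul_of_pos_right _ (Nat.choose_pos (by simpa [Nat.lt_succ_iff] using hk))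
    _ = (n + 1) ^ 3 := by
        rw [add_pow]
        simp

/-- Welzl's theorem: finitely many points in the plane are visited by a path that crosses every
line `O(√m)` times. -/
theorem exists_path_low_stabbing {ι : Type*} [Fintype ι] (r : ι → Plane) :
    ∃ l : List ι, l.Nodup ∧ (∀ i, i ∈ l) ∧ ∀ a b c,
      ((pathSum (signFlip fun p => 0 < affineForm a b c p) (l.map r) : ℕ) : ℝ) ≤
        204 * √(Fintype.card ι : ℝ) := by
  rcases isEmpty_or_nonempty ι with hι | hι
  · exact ⟨[], List.nodup_nil, fun i => hι.elim i, fun a b c => by simp [pathSum]⟩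
  obtain ⟨n, hn⟩ : ∃ n, Fintype.card ι = n + 1 :=
    ⟨Fintype.card ι - 1, by have := Fintype.card_pos (α := ι); omega⟩
  -- Half-planes with the same trace are identified, so there are only polynomially many weights.
  let pos : halfPlaneTraces r → ι → Prop := fun T i => i ∈ T.1
  have hsh : NoShatteredTriple pos univ := by
    rintro ⟨T₁, h₁⟩ ⟨T₂, h₂⟩ ⟨T₃, h₃⟩
    obtain ⟨a₁, b₁, c₁, h₁⟩ := (mem_filter.1 h₁).2
    obtain ⟨a₂, b₂, c₂, h₂⟩ := (mem_filter.1 h₂).2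
    obtain ⟨a₃, b₃, c₃, h₃⟩ := (mem_filter.1 h₃).2
    obtain ⟨s, hs⟩ := exists_missing_sign_pattern ![a₁, a₂, a₃] ![b₁, b₂, b₃] ![c₁, c₂, c₃]
    refine ⟨s 0, s 1, s 2, fun i _ ⟨k₁, k₂, k₃⟩ => hs (r i) ?_⟩
    simp only [pos, h₁, h₂, h₃] at k₁ k₂ k₃
    intro j
    fin_cases j
    · exact k₁
    · exact k₂
    · exact k₃
  obtain ⟨l, hl, hsum⟩ := exists_walk_weighted pos n univ (by rw [card_univ, hn]) hsh
    (fun _ => 1) fun _ => zero_le_one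
  refine ⟨l.dedup, List.nodup_dedup l, fun i => List.mem_dedup.2 ((hl i).2 (mem_univ i)),
    fun a b c => ?_⟩
  set m : ℝ := (Fintype.card ι : ℝ) with hm
  have hmn : (n : ℝ) + 1 = m := by rw [hm, hn]; push_cast; ring
  let T : halfPlaneTraces r := ⟨({i | 0 < affineForm a b c (r i)} : Finset ι),
    mem_filter.2 ⟨mem_univ _, a, b, c, fun i => by simp⟩⟩
  have hflip : ∀ l : List ι, pathSum (signFlip fun p => 0 < affineForm a b c p) (l.map r) =
      pathSum (signFlip (pos T)) l := by
    intro l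
    rw [pathSum_map]
    congr 1
    ext x y
    simp [signFlip, pos, T]
  rw [hflip]
  set κ := pathSum (signFlip (pos T)) l.dedup
  have h1 : (2 : ℝ) ^ κ ≤ (m + 1) ^ 3 * Real.exp (96 * √m) := by
    calc (2 : ℝ) ^ κ ≤ 2 ^ pathSum (signFlip (pos T)) l :=
          pow_le_pow_right₀ one_le_two (pathSum_signFlip_le_of_sublist _ (List.dedup_sublist l))
      _ ≤ ∑ T, 1 * (2 : ℝ) ^ pathSum (signFlip (pos T)) l := by
          simp only [one_mul]
          exact single_le_sum (f := fun T => (2 : ℝ) ^ pathSum (signFlip (pos T)) l)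
            (fun _ _ => by positivity) (mem_univ T)
      _ ≤ _ := hsum
      _ ≤ _ := by
          rw [hmn]
          gcongr
          simp only [sum_const, card_univ, Fintype.card_coe, nsmul_eq_mul, mul_one]
          rw [hm]
          exact_mod_cast card_halfPlaneTraces_le r
  have hmm : √m * √m = m := Real.mul_self_sqrt (Nat.cast_nonneg _)
  -- The number of traces contributes `6√m` to the exponent, which gives 102; division by `log 2 >
  -- 1/2` gives 204.
  have h2 : m + 1 ≤ Real.exp (2 * √m) := by
    calc m + 1 ≤ (√m + 1) ^ 2 := by nlinarith [Real.sqrt_nonneg m]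
      _ ≤ Real.exp (√m) ^ 2 := by gcongr; exact Real.add_one_le_exp _
      _ = Real.exp (2 * √m) := by rw [← Real.exp_nat_mul]; norm_num
  have h3 : (2 : ℝ) ^ κ ≤ Real.exp (102 * √m) := by
    calc _ ≤ _ := h1
      _ ≤ Real.exp (2 * √m) ^ 3 * Real.exp (96 * √m) := by gcongr
      _ = Real.exp (102 * √m) := by
          rw [← Real.exp_nat_mul, ← Real.exp_add]; congr 1; push_cast; ring
  have h4 : κ * Real.log 2 ≤ 102 * √m := by
    rw [← Real.log_pow]
    exact (Real.log_le_iff_le_exp (by positivity)).2 h3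
  have := Real.log_two_gt_d9
  nlinarith [(Nat.cast_nonneg κ : (0 : ℝ) ≤ κ)]

end LowStabbing

/-! ### Jordan curves: walks along them, lines overlapping them -/

section JordanCurves

open Set Topology

theorem pathSum_signFlip_congr {α : Type*} {P Q : α → Prop} {l : List α}
    (h : ∀ x ∈ l, (P x ↔ Q x)) : pathSum (signFlip P) l = pathSum (signFlip Q) l := by
  induction l with
  | nil => rfl
  | cons x l ih =>
    cases l with
    | nil => rfl
    | cons y l =>
      simp only [pathSum]
      rw [ih fun z hz => h z (List.mem_cons_of_mem _ hz)]
      have hx : P x ↔ Q x := h x (by simp)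
      have hy : P y ↔ Q y := h y (by simp)
      congr 1
      unfold signFlip
      split_ifs <;> first | rfl | tauto

/-- A continuous function has a zero between any two consecutive points of different signs. -/
theorem pathSum_signFlip_le_encard_zeros {φ : ℝ → ℝ} (hφ : Continuous φ) (M x : ℝ) (l : List ℝ)
    (hl : (x :: l).Pairwise (· < ·)) (hM : ∀ t ∈ x :: l, t ≤ M) (h0 : ∀ t ∈ x :: l, φ t ≠ 0) :
    ((pathSum (signFlip fun t => 0 < φ t) (x :: l) : ℕ) : ℕ∞) ≤ {t ∈ Icc x M | φ t = 0}.encard := by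
  induction l generalizing x with
  | nil => simp [pathSum]
  | cons y l ih =>
    have hxy : x < y := (List.pairwise_cons.1 hl).1 y (by simp)
    have hyM : y ≤ M := hM y (by simp)
    have ih := ih y (List.pairwise_cons.1 hl).2 (fun t ht => hM t (List.mem_cons_of_mem _ ht))
      (fun t ht => h0 t (List.mem_cons_of_mem _ ht))
    have hx0 := h0 x (by simp)
    have hy0 := h0 y (by simp)
    -- Half-open intervals keep the zeros found for different pairs distinct; the endpoint `y` is
    -- not a zero.
    have hfirst : ((signFlip (fun t => 0 < φ t) x y : ℕ) : ℕ∞) ≤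
        {t ∈ Ico x y | φ t = 0}.encard := by
      by_cases h : (0 < φ x ↔ 0 < φ y)
      · simp [signFlip, h]
      · have hz : ∃ t ∈ Icc x y, φ t = 0 := by
          by_cases hp : 0 < φ x
          · have hn : φ y ≤ 0 := not_lt.1 fun h' => h ⟨fun _ => h', fun _ => hp⟩
            exact intermediate_value_Icc' hxy.le hφ.continuousOn ⟨hn, hp.le⟩
          · have hn : 0 < φ y := by tauto
            exact intermediate_value_Icc hxy.le hφ.continuousOn ⟨not_lt.1 hp, hn.le⟩
        obtain ⟨t, ht, ht0⟩ := hz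
        have hty : t ≠ y := fun h => hy0 (h ▸ ht0)
        have : (1 : ℕ∞) ≤ {t ∈ Ico x y | φ t = 0}.encard :=
          one_le_encard_iff_nonempty.2 ⟨t, ⟨ht.1, lt_of_le_of_ne ht.2 hty⟩, ht0⟩
        refine le_trans ?_ this
        exact_mod_cast signFlip_le_one _ x y
    have hdisj : Disjoint {t ∈ Ico x y | φ t = 0} {t ∈ Icc y M | φ t = 0} :=
      Set.disjoint_left.2 fun t h1 h2 => not_lt.2 h2.1.1 h1.1.2
    calc ((pathSum (signFlip fun t => 0 < φ t) (x :: y :: l) : ℕ) : ℕ∞)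
        ≤ {t ∈ Ico x y | φ t = 0}.encard + {t ∈ Icc y M | φ t = 0}.encard := by
          simp only [pathSum, Nat.cast_add]
          exact add_le_add hfirst ih
      _ = ({t ∈ Ico x y | φ t = 0} ∪ {t ∈ Icc y M | φ t = 0}).encard := (encard_union_eq hdisj).symm
      _ ≤ _ := by
          refine encard_le_encard ?_
          rintro t (⟨h1, h2⟩ | ⟨h1, h2⟩)
          · exact ⟨⟨h1.1, h1.2.le.trans hyM⟩, h2⟩
          · exact ⟨⟨hxy.le.trans h1.1, h1.2⟩, h2⟩

theorem continuous_affineForm (a b c : ℝ) : Continuous (affineForm a b c) := by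
  unfold affineForm
  fun_prop

local instance fact_zero_lt_two_pi : Fact (0 < 2 * Real.pi) := ⟨Real.two_pi_pos⟩

theorem IsJordanCurve.exists_addCircle {J : Set Plane} (hJ : IsJordanCurve J) :
    ∃ γ : AddCircle (2 * Real.pi) → Plane, Continuous γ ∧ Function.Injective γ ∧ range γ = J := by
  obtain ⟨γ, hc, hi, rfl⟩ := hJ
  refine ⟨γ ∘ AddCircle.homeomorphCircle', hc.comp (Homeomorph.continuous _),
    hi.comp (Homeomorph.injective _), ?_⟩
  rw [range_comp, (Homeomorph.surjective _).range_eq, image_univ]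

/-- Traversing a Jordan curve from a point of a finite subset yields a closed walk. -/
theorem IsJordanCurve.exists_closed_walk {J : Set Plane} (hJ : IsJordanCurve J) (A : Finset Plane)
    (hA : A.Nonempty) (hAJ : (A : Set Plane) ⊆ J) :
    ∃ (W : List Plane) (p : Plane), W.head? = some p ∧ W.getLast? = some p ∧
      (∀ q, q ∈ W ↔ q ∈ A) ∧ ∀ a b c, (∀ q ∈ A, affineForm a b c q ≠ 0) →
        ((pathSum (signFlip fun q => 0 < affineForm a b c q) W : ℕ) : ℕ∞) ≤
          ({q | affineForm a b c q = 0} ∩ J).encard := by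
  classical
  obtain ⟨γ, hc, hi, rfl⟩ := hJ.exists_addCircle
  have hτ : ∀ q ∈ A, ∃ t ∈ Ico (0 : ℝ) (0 + 2 * Real.pi), γ (t : AddCircle (2 * Real.pi)) = q := by
    intro q hq
    obtain ⟨z, rfl⟩ := hAJ hq
    obtain ⟨t, ht, rfl⟩ := AddCircle.coe_image_Ico_eq (2 * Real.pi) 0 ▸ mem_univ z
    exact ⟨t, ht, rfl⟩
  choose! τ hτI hτγ using hτ
  set T := A.image τ with hT
  have hTI : ∀ t ∈ T, t ∈ Ico (0 : ℝ) (0 + 2 * Real.pi) := by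
    intro t ht
    obtain ⟨q, hq, rfl⟩ := Finset.mem_image.1 ht
    exact hτI q hq
  have hTA : ∀ t ∈ T, γ (t : AddCircle (2 * Real.pi)) ∈ A := by
    intro t ht
    obtain ⟨q, hq, rfl⟩ := Finset.mem_image.1 ht
    rwa [hτγ q hq]
  have hsort := T.sortedLT_sort.pairwise
  have hmem : ∀ t, t ∈ T.sort ↔ t ∈ T := fun t => Finset.mem_sort _
  obtain ⟨x, l, hxl⟩ : ∃ x l, T.sort (· ≤ ·) = x :: l := by
    apply List.exists_cons_of_ne_nil
    intro h
    obtain ⟨q, hq⟩ := hA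
    have := (hmem (τ q)).2 (Finset.mem_image_of_mem _ hq)
    simp [h] at this
  rw [hxl] at hsort hmem
  have hxT : x ∈ T := (hmem x).1 (by simp)
  set g : ℝ → Plane := fun t => γ (t : AddCircle (2 * Real.pi)) with hg
  have hper : g (x + 2 * Real.pi) = g x := by simp [hg]
  have hgc : Continuous g := hc.comp (AddCircle.continuous_mk' _)
  have hlt : ∀ t ∈ x :: l, t < x + 2 * Real.pi := by
    intro t ht
    have h1 := hTI t ((hmem t).1 ht)
    have h2 := hTI x hxT
    linarith [h1.2, h2.1]
  have hpair : (x :: (l ++ [x + 2 * Real.pi])).Pairwise (· < ·) := by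
    rw [← List.cons_append, List.pairwise_append]
    exact ⟨hsort, by simp, fun t ht s hs => by rw [List.mem_singleton.1 hs]; exact hlt t ht⟩
  refine ⟨(x :: (l ++ [x + 2 * Real.pi])).map g, g x, rfl, ?_, fun q => ?_, ?_⟩
  · rw [← List.cons_append, List.map_append, List.map_singleton, hper, List.getLast?_append]
    simp
  · constructor
    · intro hq
      obtain ⟨t, ht, rfl⟩ := List.mem_map.1 hq
      rw [← List.cons_append, List.mem_append, List.mem_singleton] at ht
      rcases ht with ht | rfl
      · exact hTA t ((hmem t).1 ht)
      · rw [hper]; exact hTA x hxT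
    · intro hq
      have := (hmem (τ q)).2 (Finset.mem_image_of_mem _ hq)
      exact List.mem_map.2 ⟨τ q, by rw [← List.cons_append]; exact List.mem_append_left _ this,
        hτγ q hq⟩
  · intro a b c h0
    have hx0 : affineForm a b c (g x) ≠ 0 := h0 _ (hTA x hxT)
    rw [pathSum_map]
    refine (pathSum_signFlip_le_encard_zeros (φ := fun t => affineForm a b c (g t))
      ((continuous_affineForm a b c).comp hgc) (x + 2 * Real.pi) x _ hpair ?_ ?_).trans ?_
    · intro t ht
      rw [← List.cons_append, List.mem_append, List.mem_singleton] at ht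
      rcases ht with ht | rfl
      · exact (hlt t ht).le
      · exact le_rfl
    · intro t ht
      rw [← List.cons_append, List.mem_append, List.mem_singleton] at ht
      rcases ht with ht | rfl
      · exact h0 _ (hTA t ((hmem t).1 ht))
      · rwa [hper]
    · have hinj : InjOn g {t ∈ Icc x (x + 2 * Real.pi) | affineForm a b c (g t) = 0} := by
        intro s hs t ht hst
        have hmemI : ∀ u, u ∈ {t ∈ Icc x (x + 2 * Real.pi) | affineForm a b c (g t) = 0} →
            u ∈ Ico x (x + 2 * Real.pi) := by
          intro u hu
          refine ⟨hu.1.1, lt_of_le_of_ne hu.1.2 fun h => hx0 ?_⟩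
          rw [← hper, ← h]
          exact hu.2
        exact (AddCircle.coe_eq_coe_iff_of_mem_Ico (hmemI s hs) (hmemI t ht)).1 (hi hst)
      rw [← hinj.encard_image]
      refine encard_le_encard ?_
      rintro _ ⟨t, ht, rfl⟩
      exact ⟨ht.2, mem_range_self _⟩

/-- Either `K` is the whole circle, or it avoids a point and can be moved by a chart to the real
line, where a connected set with two points contains an open interval. -/
theorem interior_nonempty_of_isPreconnected_addCircle {K : Set (AddCircle (2 * Real.pi))}
    (hK : IsPreconnected K) (hnt : K.Nontrivial) : (interior K).Nonempty := by
  by_cases hu : K = univ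
  · rw [hu, interior_univ]
    exact ⟨0, mem_univ _⟩
  obtain ⟨z, hz⟩ := (ne_univ_iff_exists_notMem K).1 hu
  induction z using QuotientAddGroup.induction_on with | H a => ?_
  let e := AddCircle.openPartialHomeomorphCoe (2 * Real.pi) a
  have hKt : K ⊆ e.target := fun x hx h => hz (by rw [← mem_singleton_iff.1 h]; exact hx)
  have hpre : IsPreconnected (e.symm '' K) := hK.image _ (e.continuousOn_symm.mono hKt)
  obtain ⟨x, hx, y, hy, hxy⟩ := hnt
  have hne : e.symm x ≠ e.symm y := fun h => hxy (e.symm.injOn (hKt hx) (hKt hy) h)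
  have key : ∀ u ∈ e.symm '' K, ∀ v ∈ e.symm '' K, u < v → (interior K).Nonempty := by
    intro u hu v hv huv
    have hsub : Ioo u v ⊆ e.symm '' K := Ioo_subset_Icc_self.trans (hpre.Icc_subset hu hv)
    have hsrc : Ioo u v ⊆ e.source := by
      intro t ht
      obtain ⟨w, hw, rfl⟩ := hsub ht
      exact e.map_target (hKt hw)
    have hopen := e.isOpen_image_of_subset_source isOpen_Ioo hsrc
    have himg : e '' Ioo u v ⊆ K := by
      rintro _ ⟨t, ht, rfl⟩
      obtain ⟨w, hw, rfl⟩ := hsub ht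
      rwa [e.right_inv (hKt hw)]
    exact ((nonempty_Ioo.2 huv).image e).mono (interior_maximal himg hopen)
  rcases lt_or_gt_of_ne hne with h | h
  · exact key _ (mem_image_of_mem _ hx) _ (mem_image_of_mem _ hy) h
  · exact key _ (mem_image_of_mem _ hy) _ (mem_image_of_mem _ hx) h

/-- Only countably many lines of a parallel pencil overlap a Jordan curve in a segment. -/
theorem IsJordanCurve.countable_overlap {J : Set Plane} (hJ : IsJordanCurve J) (a b : ℝ) :
    {c | ContainsSegment ({p | affineForm a b c p = 0} ∩ J)}.Countable := by
  obtain ⟨γ, hc, hi, rfl⟩ := hJ.exists_addCircle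
  -- Parallel lines pull back to disjoint subsets of the circle, each with interior if its line
  -- overlaps the curve; a separable space holds only countably many of these.
  refine Set.PairwiseDisjoint.countable_of_nonempty_interior
    (s := fun c => {z | affineForm a b c (γ z) = 0}) ?_ ?_
  · intro c _ c' _ hcc'
    refine Set.disjoint_left.2 fun z hz hz' => hcc' ?_
    simp only [affineForm, mem_ofPred_eq] at hz hz'
    linarith
  · rintro c ⟨p, q, hpq, hsub⟩
    have hemb : IsClosedEmbedding γ := hc.isClosedEmbedding hi
    have hran : segment ℝ p q ⊆ range γ := fun x hx => (hsub hx).2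
    have himg : γ '' (γ ⁻¹' segment ℝ p q) = segment ℝ p q := image_preimage_eq_of_subset hran
    have hpre : IsPreconnected (γ ⁻¹' segment ℝ p q) := by
      rw [← hemb.isInducing.isPreconnected_image, himg]
      exact (convex_segment p q).isPreconnected
    obtain ⟨x, hx⟩ := hran (left_mem_segment ℝ p q)
    obtain ⟨y, hy⟩ := hran (right_mem_segment ℝ p q)
    have hnt : (γ ⁻¹' segment ℝ p q).Nontrivial := by
      refine ⟨x, ?_, y, ?_, fun h => hpq ?_⟩
      · rw [mem_preimage, hx]; exact left_mem_segment ℝ p q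
      · rw [mem_preimage, hy]; exact right_mem_segment ℝ p q
      · rw [← hx, ← hy, h]
    exact (interior_nonempty_of_isPreconnected_addCircle hpre hnt).mono
      (interior_mono fun z hz => (hsub hz).1)

theorem IsJordanCurve.isClosed {J : Set Plane} (hJ : IsJordanCurve J) : IsClosed J := by
  obtain ⟨γ, hc, hi, rfl⟩ := hJ
  exact (isCompact_range hc).isClosed

/-- A segment that is covered by finitely many closed sets has a subsegment in one of them. -/
theorem ContainsSegment.exists_of_iUnion {ι : Type*} [Finite ι] {L : Set Plane} {B : ι → Set Plane}
    (hB : ∀ i, IsClosed (B i)) (h : ContainsSegment (L ∩ ⋃ i, B i)) :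
    ∃ i, ContainsSegment (L ∩ B i) := by
  obtain ⟨p, q, hpq, hsub⟩ := h
  let f : unitInterval → Plane := fun t => AffineMap.lineMap p q (t : ℝ)
  have hf : Continuous f := by fun_prop
  have hmem : ∀ t, f t ∈ segment ℝ p q := fun t => by
    rw [segment_eq_image_lineMap]
    exact ⟨t, t.2, rfl⟩
  -- Baire category on the unit interval.
  obtain ⟨i, hi⟩ := nonempty_interior_of_iUnion_of_closed (f := fun i => f ⁻¹' B i)
    (fun i => (hB i).preimage hf) (by
      refine eq_univ_of_forall fun t => ?_
      obtain ⟨i, hi⟩ := mem_iUnion.1 (hsub (hmem t)).2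
      exact mem_iUnion.2 ⟨i, hi⟩)
  obtain ⟨t, ht⟩ := hi
  have : ∃ u v : unitInterval, u < v ∧ Icc u v ⊆ f ⁻¹' B i := by
    obtain ⟨u, v, htuv, hnhds, hsub⟩ :=
      exists_Icc_mem_subset_of_mem_nhds (mem_interior_iff_mem_nhds.1 ht)
    refine ⟨u, v, lt_of_le_of_ne (htuv.1.trans htuv.2) ?_, hsub⟩
    rintro rfl
    rw [Icc_self] at htuv hnhds
    rw [← mem_singleton_iff.1 htuv] at hnhds
    have : ({t} ∩ {t}ᶜ : Set unitInterval) ∈ 𝓝[≠] t :=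
      Filter.inter_mem (mem_nhdsWithin_of_mem_nhds hnhds) self_mem_nhdsWithin
    rw [inter_compl_self] at this
    exact Filter.empty_notMem _ this
  obtain ⟨u, v, huv, huvB⟩ := this
  refine ⟨i, f u, f v, fun h => ?_, fun x hx => ?_⟩
  · exact huv.ne (Subtype.ext (AffineMap.lineMap_injective ℝ hpq h))
  · rw [segment_eq_image_lineMap] at hx
    obtain ⟨s, hs, rfl⟩ := hx
    have hu := u.2
    have hv := v.2
    have huv' : (u : ℝ) < v := huv
    have hw1 : (u : ℝ) ≤ AffineMap.lineMap (u : ℝ) (v : ℝ) s := by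
      rw [AffineMap.lineMap_apply_ring']; nlinarith [hs.1]
    have hw2 : AffineMap.lineMap (u : ℝ) (v : ℝ) s ≤ (v : ℝ) := by
      rw [AffineMap.lineMap_apply_ring']; nlinarith [hs.2]
    let w : unitInterval := ⟨AffineMap.lineMap (u : ℝ) (v : ℝ) s, hu.1.trans hw1, hw2.trans hv.2⟩
    have hw : AffineMap.lineMap (f u) (f v) s = f w := by
      simp only [f, w, AffineMap.lineMap_apply_module]
      module
    rw [hw]
    exact ⟨(hsub (hmem w)).1, huvB ⟨hw1, hw2⟩⟩

end JordanCurves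

/-! ### Moving lines into generic position -/

section Perturbation

open Set Topology

theorem isLine_affineForm {a b : ℝ} (hab : a ≠ 0 ∨ b ≠ 0) (c : ℝ) :
    IsLine {p | affineForm a b c p = 0} :=
  ⟨a, b, c, hab, by ext p; simp [affineForm, sub_eq_zero]⟩

theorem IsLine.exists_affineForm {L : Set Plane} (hL : IsLine L) :
    ∃ a b c, (a ≠ 0 ∨ b ≠ 0) ∧ L = {p | affineForm a b c p = 0} := by
  obtain ⟨a, b, c, hab, rfl⟩ := hL
  exact ⟨a, b, c, hab, by ext p; simp [affineForm, sub_eq_zero]⟩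

theorem encard_le_stab {J L : Set Plane} (hL : IsLine L) (h : ¬ ContainsSegment (L ∩ J)) :
    (L ∩ J).encard ≤ stab J :=
  le_iSup₂_of_le L hL (le_iSup_of_le h le_rfl)

/-- A line that misses a finite set can be translated, without passing a point of the set, to a
line that avoids countably many parallel lines. -/
theorem exists_translate_notMem (X : Finset Plane) (a b c : ℝ)
    (h0 : ∀ p ∈ X, affineForm a b c p ≠ 0) {S : Set ℝ} (hS : S.Countable) :
    ∃ c' ∉ S, ∀ p ∈ X, affineForm a b c' p ≠ 0 ∧
      (0 < affineForm a b c p ↔ 0 < affineForm a b c' p) := by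
  have hU : IsOpen {c' | ∀ p ∈ X, 0 < affineForm a b c p * affineForm a b c' p} := by
    have : {c' | ∀ p ∈ X, 0 < affineForm a b c p * affineForm a b c' p} =
        ⋂ p ∈ X, {c' | 0 < affineForm a b c p * affineForm a b c' p} := by ext; simp
    rw [this]
    refine isOpen_biInter_finset fun p _ => isOpen_lt continuous_const ?_
    unfold affineForm
    fun_prop
  obtain ⟨c', hc', hc'S⟩ := (hS.dense_compl ℝ).inter_open_nonempty _ hU
    ⟨c, fun p hp => mul_self_pos.2 (h0 p hp)⟩
  refine ⟨c', hc'S, fun p hp => ?_⟩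
  have := hc' p hp
  refine ⟨fun h => by simp [h] at this, ?_⟩
  rcases pos_and_pos_or_neg_and_neg_of_mul_pos this with ⟨h1, h2⟩ | ⟨h1, h2⟩
  · simp [h1, h2]
  · simp [h1.le.not_gt, h2.le.not_gt]

/-- If every `W i` crosses a generic line at most as often as the Jordan curve `B i` does, then
all of them together cross it at most `stab (⋃ i, B i)` times. -/
theorem sum_pathSum_signFlip_le_stab {ι : Type*} [Fintype ι] (B : ι → Set Plane)
    (hB : ∀ i, IsJordanCurve (B i)) (hcount : ∀ i j, i ≠ j → (B i ∩ B j).Countable)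
    (W : ι → List Plane) (X : Finset Plane) (hWX : ∀ i, ∀ q ∈ W i, q ∈ X)
    (hW : ∀ i a b c, (∀ q ∈ X, affineForm a b c q ≠ 0) →
      ((pathSum (signFlip fun q => 0 < affineForm a b c q) (W i) : ℕ) : ℕ∞) ≤
        ({q | affineForm a b c q = 0} ∩ B i).encard)
    (a b c : ℝ) (h0 : ∀ q ∈ X, affineForm a b c q ≠ 0) :
    ((∑ i, pathSum (signFlip fun q => 0 < affineForm a b c q) (W i) : ℕ) : ℕ∞) ≤
      stab (⋃ i, B i) := by
  by_cases hab : a ≠ 0 ∨ b ≠ 0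
  · have hS : ((⋃ i, ⋃ j, ⋃ (_ : i ≠ j), (fun p : Plane => a * p 0 + b * p 1) '' (B i ∩ B j)) ∪
        ⋃ i, {c | ContainsSegment ({p | affineForm a b c p = 0} ∩ B i)}).Countable := by
      refine .union ?_ (countable_iUnion fun i => (hB i).countable_overlap a b)
      exact countable_iUnion fun i => countable_iUnion fun j => countable_iUnion fun hij =>
        (hcount i j hij).image _
    obtain ⟨c', hc', hX⟩ := exists_translate_notMem X a b c h0 hS
    simp only [mem_union, mem_iUnion, not_or, not_exists, mem_image, not_and] at hc'
    have hdisj : Pairwise (Function.onFun Disjoint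
        fun i => {p | affineForm a b c' p = 0} ∩ B i) := by
      intro i j hij
      refine Set.disjoint_left.2 fun p hp hp' => hc'.1 i j hij p ⟨hp.2, hp'.2⟩ ?_
      have := hp.1
      simp only [affineForm, mem_ofPred_eq] at this
      linarith
    have hseg : ¬ ContainsSegment ({p | affineForm a b c' p = 0} ∩ ⋃ i, B i) := by
      intro h
      obtain ⟨i, hi⟩ := h.exists_of_iUnion fun i => (hB i).isClosed
      exact hc'.2 i hi
    calc ((∑ i, pathSum (signFlip fun q => 0 < affineForm a b c q) (W i) : ℕ) : ℕ∞)
        = ∑ i, ((pathSum (signFlip fun q => 0 < affineForm a b c' q) (W i) : ℕ) : ℕ∞) := by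
          rw [Nat.cast_sum]
          refine Finset.sum_congr rfl fun i _ => ?_
          rw [pathSum_signFlip_congr fun q hq => (hX q (hWX i q hq)).2]
      _ ≤ ∑ i, ({q | affineForm a b c' q = 0} ∩ B i).encard :=
          Finset.sum_le_sum fun i _ => hW i a b c' fun q hq => (hX q hq).1
      _ = ({q | affineForm a b c' q = 0} ∩ ⋃ i, B i).encard := by
          rw [inter_iUnion, encard_iUnion_of_finite hdisj, finsum_eq_sum_of_fintype]
      _ ≤ _ := encard_le_stab (isLine_affineForm hab c') hseg
  · push Not at hab
    have : ∀ i, pathSum (signFlip fun q => 0 < affineForm a b c q) (W i) = 0 := by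
      intro i
      have h : (signFlip fun q => 0 < affineForm a b c q) = fun _ _ => 0 := by
        ext x y
        simp [signFlip, affineForm, hab.1, hab.2]
      rw [h, pathSum_eq_sum_range _ 0]
      simp
    simp [this]

theorem collinear_of_affineForm_eq_zero {a b c : ℝ} (hab : a ≠ 0 ∨ b ≠ 0) {S : Set Plane}
    (hS : ∀ p ∈ S, affineForm a b c p = 0) : Collinear ℝ S := by
  rcases S.eq_empty_or_nonempty with rfl | ⟨p, hp⟩
  · exact collinear_empty ℝ Plane
  · rw [collinear_iff_of_mem hp]
    have hd : 0 < a ^ 2 + b ^ 2 := by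
      rcases hab with h | h
      · have := sq_pos_of_ne_zero h
        positivity
      · have := sq_pos_of_ne_zero h
        positivity
    refine ⟨!₂[-b, a], fun x hx =>
      ⟨(-b * (x 0 - p 0) + a * (x 1 - p 1)) / (a ^ 2 + b ^ 2), ?_⟩⟩
    have h1 := hS p hp
    have h2 := hS x hx
    simp only [affineForm] at h1 h2
    ext i
    fin_cases i
    · simp
      field_simp
      linear_combination a * (h2 - h1)
    · simp
      field_simp
      linear_combination b * (h2 - h1)

theorem exists_affineForm_eq (p q : Plane) (hpq : p ≠ q) (s t : ℝ) :
    ∃ a b c, affineForm a b c p = s ∧ affineForm a b c q = t := by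
  have hd : 0 < (q 0 - p 0) ^ 2 + (q 1 - p 1) ^ 2 := by
    by_contra! h
    refine hpq ?_
    have h0 : q 0 - p 0 = 0 := by nlinarith [sq_nonneg (q 0 - p 0), sq_nonneg (q 1 - p 1)]
    have h1 : q 1 - p 1 = 0 := by nlinarith [sq_nonneg (q 0 - p 0), sq_nonneg (q 1 - p 1)]
    ext i
    fin_cases i
    · simp; linarith
    · simp; linarith
  set d := (q 0 - p 0) ^ 2 + (q 1 - p 1) ^ 2 with hdef
  refine ⟨(t - s) / d * (q 0 - p 0), (t - s) / d * (q 1 - p 1),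
    (t - s) / d * (q 0 - p 0) * p 0 + (t - s) / d * (q 1 - p 1) * p 1 - s, ?_, ?_⟩
  · simp only [affineForm]; ring
  · have : (t - s) / d * d = t - s := div_mul_cancel₀ _ hd.ne'
    simp only [affineForm]
    linear_combination this - (t - s) / d * hdef

/-- A line through points of a set in general position can be moved off the set so that the points
on it fall on prescribed sides. -/
theorem exists_perturbation {X : Finset Plane} (hX : InGeneralPosition (X : Set Plane))
    {a b : ℝ} (hab : a ≠ 0 ∨ b ≠ 0) (c : ℝ) (σ : Plane → Prop) :
    ∃ a' b' c', ∀ p ∈ X, affineForm a' b' c' p ≠ 0 ∧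
      (0 < affineForm a b c p → 0 < affineForm a' b' c' p) ∧
      (affineForm a b c p < 0 → affineForm a' b' c' p < 0) ∧
      (affineForm a b c p = 0 → (0 < affineForm a' b' c' p ↔ σ p)) := by
  classical
  -- By general position at most two points of `X` lie on the line, so an affine form can take
  -- prescribed values there. A small positive multiple of it is then added without disturbing the
  -- other signs.
  have hg : ∃ a₁ b₁ c₁, ∀ p ∈ X, affineForm a b c p = 0 →
      affineForm a₁ b₁ c₁ p = if σ p then 1 else -1 := by
    by_cases hex : ∃ p ∈ X, ∃ q ∈ X, p ≠ q ∧ affineForm a b c p = 0 ∧ affineForm a b c q = 0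
    · obtain ⟨p, hp, q, hq, hpq, hp0, hq0⟩ := hex
      obtain ⟨a₁, b₁, c₁, h1, h2⟩ :=
        exists_affineForm_eq p q hpq (if σ p then 1 else -1) (if σ q then 1 else -1)
      refine ⟨a₁, b₁, c₁, fun r hr hr0 => ?_⟩
      by_cases hrp : p = r
      · rw [← hrp, h1]
      by_cases hrq : q = r
      · rw [← hrq, h2]
      refine absurd (collinear_of_affineForm_eq_zero hab (c := c) ?_) (hX p hp q hq r hr hpq hrp hrq)
      simp [hp0, hq0, hr0]
    · by_cases hex' : ∃ p ∈ X, affineForm a b c p = 0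
      · obtain ⟨p, hp, hp0⟩ := hex'
        refine ⟨0, 0, -(if σ p then 1 else -1), fun r hr hr0 => ?_⟩
        have : r = p := by
          by_contra h
          exact hex ⟨r, hr, p, hp, h, hr0, hp0⟩
        rw [this]
        simp [affineForm]
      · exact ⟨0, 0, 0, fun r hr hr0 => absurd ⟨r, hr, hr0⟩ hex'⟩
  obtain ⟨a₁, b₁, c₁, hg⟩ := hg
  have hform : ∀ η p, affineForm (a + η * a₁) (b + η * b₁) (c + η * c₁) p =
      affineForm a b c p + η * affineForm a₁ b₁ c₁ p := by
    intro η p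
    simp only [affineForm]
    ring
  have hev : ∀ᶠ η : ℝ in 𝓝[>] 0, ∀ p ∈ X,
      affineForm (a + η * a₁) (b + η * b₁) (c + η * c₁) p ≠ 0 ∧
      (0 < affineForm a b c p → 0 < affineForm (a + η * a₁) (b + η * b₁) (c + η * c₁) p) ∧
      (affineForm a b c p < 0 → affineForm (a + η * a₁) (b + η * b₁) (c + η * c₁) p < 0) ∧
      (affineForm a b c p = 0 →
        (0 < affineForm (a + η * a₁) (b + η * b₁) (c + η * c₁) p ↔ σ p)) := by
    rw [Filter.eventually_all_finset]
    intro p hp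
    simp only [hform]
    have hcont : Filter.Tendsto (fun η : ℝ => affineForm a b c p + η * affineForm a₁ b₁ c₁ p)
        (𝓝[>] 0) (𝓝 (affineForm a b c p)) := by
      have : Continuous fun η : ℝ => affineForm a b c p + η * affineForm a₁ b₁ c₁ p := by fun_prop
      have := this.tendsto 0
      simp only [zero_mul, add_zero] at this
      exact this.mono_left nhdsWithin_le_nhds
    rcases lt_trichotomy (affineForm a b c p) 0 with h | h | h
    · filter_upwards [hcont.eventually_lt_const h] with η hη
      exact ⟨hη.ne, fun h' => absurd h' h.le.not_gt, fun _ => hη, fun h' => absurd h' h.ne⟩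
    · filter_upwards [self_mem_nhdsWithin] with η hη
      have hη : (0 : ℝ) < η := hη
      rw [hg p hp h, h]
      by_cases hσ : σ p
      · simp [hσ, hη.ne', hη]
      · simp [hσ, hη.ne', hη.le]
    · filter_upwards [hcont.eventually_const_lt h] with η hη
      exact ⟨hη.ne', fun _ => hη, fun h' => absurd h' h.le.not_gt, fun h' => absurd h' h.ne'⟩
  obtain ⟨η, hη⟩ := hev.exists
  exact ⟨_, _, _, hη⟩

end Perturbation

/-! ### Closed polygons, their stabbing number and uncrossing -/

section Polygons

open Set

/-- The closed polygon with vertices `v 0, …, v n = v 0`. -/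
def closedPolygon (v : ℕ → Plane) (n : ℕ) : Set Plane :=
  {x | ∃ i < n, ∃ s ∈ Ico (0 : ℝ) 1, AffineMap.lineMap (v i) (v (i + 1)) s = x}

/-- The hat-function parametrization of a polygonal path. -/
noncomputable def polygonParam (v : ℕ → Plane) (n : ℕ) (t : ℝ) : Plane :=
  ∑ k ∈ Finset.range (n + 1), max 0 (1 - |t - k|) • v k

theorem polygonParam_add (v : ℕ → Plane) {n i : ℕ} (hi : i < n) {s : ℝ} (hs : s ∈ Icc (0 : ℝ) 1) :
    polygonParam v n (i + s) = AffineMap.lineMap (v i) (v (i + 1)) s := by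
  unfold polygonParam
  rw [Finset.sum_eq_add_of_mem i (i + 1) (by simp; omega) (by simp; omega) (by omega)]
  · have h1 : |(i : ℝ) + s - i| = s := by rw [add_sub_cancel_left, abs_of_nonneg hs.1]
    have h2 : |(i : ℝ) + s - (i + 1 : ℕ)| = 1 - s := by
      rw [abs_of_nonpos (by push_cast; linarith [hs.2])]
      push_cast
      ring
    rw [h1, h2, max_eq_right (by linarith [hs.2]), max_eq_right (by linarith [hs.1]),
      AffineMap.lineMap_apply_module]
    congr 2
    ring
  · rintro k - ⟨h1, h2⟩
    rw [max_eq_left, zero_smul]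
    rcases Nat.lt_or_ge k i with h | h
    · have : (k : ℝ) + 1 ≤ i := by exact_mod_cast h
      linarith [le_abs_self ((i : ℝ) + s - k), hs.1]
    · have : (i : ℝ) + 2 ≤ k := by exact_mod_cast (show i + 2 ≤ k by omega)
      linarith [neg_abs_le ((i : ℝ) + s - k), hs.2]

theorem exists_nat_add_of_mem_Ico {n : ℕ} {t : ℝ} (ht : t ∈ Ico (0 : ℝ) n) :
    ∃ i < n, ∃ s ∈ Ico (0 : ℝ) 1, t = i + s := by
  refine ⟨⌊t⌋₊, (Nat.floor_lt ht.1).2 ht.2, t - ⌊t⌋₊, ⟨?_, ?_⟩, by ring⟩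
  · linarith [Nat.floor_le ht.1]
  · linarith [Nat.lt_floor_add_one t]

theorem isJordanCurve_closedPolygon (v : ℕ → Plane) (n : ℕ) (hn : 0 < n) (hclose : v n = v 0)
    (hedge : ∀ i < n, v i ≠ v (i + 1))
    (hsimple : ∀ i < n, ∀ j < n, i ≠ j → ∀ s ∈ Ico (0 : ℝ) 1, ∀ t ∈ Ico (0 : ℝ) 1,
      AffineMap.lineMap (v i) (v (i + 1)) s ≠ AffineMap.lineMap (v j) (v (j + 1)) t) :
    IsJordanCurve (closedPolygon v n) := by
  have hn' : (0 : ℝ) < n := by exact_mod_cast hn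
  have : Fact ((0 : ℝ) < n) := ⟨hn'⟩
  have hval : ∀ i < n, ∀ s ∈ Ico (0 : ℝ) 1,
      polygonParam v n (i + s) = AffineMap.lineMap (v i) (v (i + 1)) s :=
    fun i hi s hs => polygonParam_add v hi ⟨hs.1, hs.2.le⟩
  have h0 : polygonParam v n 0 = v 0 := by
    have := polygonParam_add v hn (s := 0) ⟨le_rfl, zero_le_one⟩
    simpa using this
  have hN : polygonParam v n n = v 0 := by
    have := polygonParam_add v (show n - 1 < n by omega) (s := 1) ⟨zero_le_one, le_rfl⟩
    rw [AffineMap.lineMap_apply_one, Nat.sub_add_cancel hn, hclose] at this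
    rw [← this, Nat.cast_pred hn]
    congr 1
    ring
  have hcont : Continuous (polygonParam v n) := by unfold polygonParam; fun_prop
  let γ : AddCircle (n : ℝ) → Plane := AddCircle.liftIco (n : ℝ) 0 (polygonParam v n)
  have hγ : Continuous γ :=
    AddCircle.liftIco_continuous (by rw [zero_add, h0, hN]) hcont.continuousOn
  have hγt : ∀ t ∈ Ico (0 : ℝ) n, γ (t : AddCircle (n : ℝ)) = polygonParam v n t :=
    fun t ht => AddCircle.liftIco_zero_coe_apply ht
  have hsurj : ∀ z : AddCircle (n : ℝ), ∃ t ∈ Ico (0 : ℝ) n, (t : AddCircle (n : ℝ)) = z := by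
    intro z
    obtain ⟨t, ht, rfl⟩ := AddCircle.coe_image_Ico_eq (n : ℝ) 0 ▸ mem_univ z
    exact ⟨t, by rwa [zero_add] at ht, rfl⟩
  have hinj : Function.Injective γ := by
    intro z w hzw
    obtain ⟨t, ht, rfl⟩ := hsurj z
    obtain ⟨u, hu, rfl⟩ := hsurj w
    rw [hγt t ht, hγt u hu] at hzw
    obtain ⟨i, hi, s, hs, rfl⟩ := exists_nat_add_of_mem_Ico ht
    obtain ⟨j, hj, s', hs', rfl⟩ := exists_nat_add_of_mem_Ico hu
    rw [hval i hi s hs, hval j hj s' hs'] at hzw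
    by_cases hij : i = j
    · subst hij
      rw [AffineMap.lineMap_injective ℝ (hedge i hi) hzw]
    · exact absurd hzw (hsimple i hi j hj hij s hs s' hs')
  let e := AddCircle.homeomorphCircle (T := (n : ℝ)) hn'.ne'
  refine ⟨γ ∘ e.symm, hγ.comp e.symm.continuous, hinj.comp e.symm.injective, ?_⟩
  rw [range_comp, e.symm.surjective.range_eq, image_univ]
  ext x
  constructor
  · rintro ⟨z, rfl⟩
    obtain ⟨t, ht, rfl⟩ := hsurj z
    rw [hγt t ht]
    obtain ⟨i, hi, s, hs, rfl⟩ := exists_nat_add_of_mem_Ico ht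
    exact ⟨i, hi, s, hs, (hval i hi s hs).symm⟩
  · rintro ⟨i, hi, s, hs, rfl⟩
    have hi' : (i : ℝ) + 1 ≤ n := by exact_mod_cast hi
    refine ⟨((i + s : ℝ) : AddCircle (n : ℝ)), ?_⟩
    rw [hγt _ ⟨add_nonneg (Nat.cast_nonneg i) hs.1, by linarith [hs.2]⟩, hval i hi s hs]

theorem affineForm_lineMap (a b c : ℝ) (p q : Plane) (s : ℝ) :
    affineForm a b c (AffineMap.lineMap p q s) =
      (1 - s) * affineForm a b c p + s * affineForm a b c q := by
  simp only [affineForm, AffineMap.lineMap_apply_module, PiLp.add_apply, PiLp.smul_apply,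
    smul_eq_mul]
  ring

theorem segment_subset_closedPolygon (v : ℕ → Plane) {n i : ℕ} (hclose : v n = v 0) (hi : i < n) :
    segment ℝ (v i) (v (i + 1)) ⊆ closedPolygon v n := by
  intro x hx
  rw [segment_eq_image_lineMap] at hx
  obtain ⟨s, hs, rfl⟩ := hx
  rcases hs.2.lt_or_eq with h | rfl
  · exact ⟨i, hi, s, ⟨hs.1, h⟩, rfl⟩
  · rw [AffineMap.lineMap_apply_one]
    rcases Nat.lt_or_ge (i + 1) n with h | h
    · exact ⟨i + 1, h, 0, by simp, by simp⟩
    · rw [show i + 1 = n by omega, hclose]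
      exact ⟨0, by omega, 0, by simp, by simp⟩

/-- The stabbing number of a closed polygon in general position is attained by lines that miss all
vertices. -/
theorem stab_closedPolygon_le (X : Finset Plane) (hX : InGeneralPosition (X : Set Plane))
    (v : ℕ → Plane) (n : ℕ) (hclose : v n = v 0) (hvX : ∀ i, v i ∈ X)
    (hinj : ∀ i < n, ∀ j < n, v i = v j → i = j) (hedge : ∀ i < n, v i ≠ v (i + 1)) (D : ℕ)
    (hD : ∀ a b c, (∀ p ∈ X, affineForm a b c p ≠ 0) →
      ∑ i ∈ Finset.range n, signFlip (fun p => 0 < affineForm a b c p) (v i) (v (i + 1)) ≤ D) :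
    stab (closedPolygon v n) ≤ D := by
  classical
  refine iSup_le fun L => iSup_le fun hL => iSup_le fun hseg => ?_
  obtain ⟨a, b, c, hab, rfl⟩ := hL.exists_affineForm
  have hinj' : ∀ i < n, ∀ j < n, v (i + 1) = v (j + 1) → i = j := by
    intro i hi j hj h
    rcases Nat.lt_or_ge (i + 1) n with hi' | hi' <;> rcases Nat.lt_or_ge (j + 1) n with hj' | hj'
    · have := hinj _ hi' _ hj' h; omega
    · rw [show j + 1 = n by omega, hclose] at h
      have := hinj _ hi' _ (by omega) h; omega
    · rw [show i + 1 = n by omega, hclose] at h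
      have := hinj _ (by omega) _ hj' h; omega
    · omega
  have hnot : ∀ i < n, ¬ (affineForm a b c (v i) = 0 ∧ affineForm a b c (v (i + 1)) = 0) := by
    rintro i hi ⟨h1, h2⟩
    refine hseg ⟨v i, v (i + 1), hedge i hi,
      fun x hx => ⟨?_, segment_subset_closedPolygon v hclose hi hx⟩⟩
    rw [segment_eq_image_lineMap] at hx
    obtain ⟨s, hs, rfl⟩ := hx
    simp [affineForm_lineMap, h1, h2]
  -- Each vertex on the line is pushed to the side opposite to its predecessor, so the side entering
  -- it becomes a crossing. Every intersection point is charged to a side parametrized by `(0, 1]`,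
  -- a vertex to its incoming side. By `hnot` a side meets the line at most once, so the charging is
  -- injective.
  obtain ⟨a', b', c', hpert⟩ := exists_perturbation hX hab c
    fun q => ∃ k < n, v (k + 1) = q ∧ affineForm a b c (v k) < 0
  set K := {i ∈ Finset.range n |
    signFlip (fun p => 0 < affineForm a' b' c' p) (v i) (v (i + 1)) = 1} with hK
  have hKcard : K.card ≤ D := by
    refine le_trans ?_ (hD a' b' c' fun p hp => (hpert p hp).1)
    rw [Finset.card_eq_sum_ones]
    calc _ = ∑ i ∈ K, signFlip (fun p => 0 < affineForm a' b' c' p) (v i) (v (i + 1)) :=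
          Finset.sum_congr rfl fun i hi => (Finset.mem_filter.1 hi).2.symm
      _ ≤ _ := Finset.sum_le_sum_of_subset (Finset.filter_subset _ _)
  have hmem : ∀ x ∈ {p | affineForm a b c p = 0} ∩ closedPolygon v n, ∃ k ∈ K,
      ∃ s ∈ Ioc (0 : ℝ) 1, AffineMap.lineMap (v k) (v (k + 1)) s = x := by
    rintro x ⟨hx0, i, hi, s, hs, rfl⟩
    have hvertex : ∀ k < n, affineForm a b c (v (k + 1)) = 0 → k ∈ K := by
      intro k hk h0
      have hk0 : affineForm a b c (v k) ≠ 0 := fun h => hnot k hk ⟨h, h0⟩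
      refine Finset.mem_filter.2 ⟨Finset.mem_range.2 hk, ?_⟩
      have h1 := hpert _ (hvX k)
      have h2 := (hpert _ (hvX (k + 1))).2.2.2 h0
      rcases lt_or_gt_of_ne hk0 with h | h
      · have h3 := h2.2 ⟨k, hk, rfl, h⟩
        have h4 := (h1.2.2.1 h).le.not_gt
        simp [signFlip, h3, h4]
      · have h3 : ¬ 0 < affineForm a' b' c' (v (k + 1)) := by
          rw [h2]
          rintro ⟨j, hj, hjk, hneg⟩
          rw [hinj' j hj k hk hjk] at hneg
          exact lt_asymm h hneg
        have h4 := h1.2.1 h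
        simp [signFlip, h3, h4]
    have hx0 : affineForm a b c (AffineMap.lineMap (v i) (v (i + 1)) s) = 0 := hx0
    rcases hs.1.eq_or_lt with rfl | hs0
    · rw [AffineMap.lineMap_apply_zero] at hx0 ⊢
      obtain ⟨k, hk, hki⟩ : ∃ k < n, v (k + 1) = v i := by
        rcases Nat.eq_zero_or_pos i with rfl | h
        · exact ⟨n - 1, by omega, by rw [Nat.sub_add_cancel (by omega), hclose]⟩
        · exact ⟨i - 1, by omega, by rw [Nat.sub_add_cancel h]⟩
      exact ⟨k, hvertex k hk (hki ▸ hx0), 1, by simp, by simp [hki]⟩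
    · refine ⟨i, Finset.mem_filter.2 ⟨Finset.mem_range.2 hi, ?_⟩, s, ⟨hs0, hs.2.le⟩, rfl⟩
      rw [affineForm_lineMap] at hx0
      have h1s : 0 < 1 - s := by linarith [hs.2]
      have h1 := hpert _ (hvX i)
      have h2 := hpert _ (hvX (i + 1))
      rcases lt_trichotomy (affineForm a b c (v i)) 0 with h | h | h
      · have h' : 0 < affineForm a b c (v (i + 1)) := by
          by_contra! hle
          nlinarith [mul_neg_of_pos_of_neg h1s h]
        have h3 := (h1.2.2.1 h).le.not_gt
        have h4 := h2.2.1 h'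
        simp [signFlip, h3, h4]
      · refine absurd ⟨h, ?_⟩ (hnot i hi)
        rw [h, mul_zero, zero_add] at hx0
        exact (mul_eq_zero.1 hx0).resolve_left hs0.ne'
      · have h' : affineForm a b c (v (i + 1)) < 0 := by
          by_contra! hle
          nlinarith [mul_pos h1s h]
        have h3 := h1.2.1 h
        have h4 := (h2.2.2.1 h').le.not_gt
        simp [signFlip, h3, h4]
  choose! k hkK s hs hkx using hmem
  have hinjOn : InjOn k ({p | affineForm a b c p = 0} ∩ closedPolygon v n) := by
    intro x hx y hy hxy
    have hkn : k x < n := Finset.mem_range.1 (Finset.mem_filter.1 (hkK x hx)).1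
    have hx1 := hkx x hx
    have hy1 := hkx y hy
    rw [← hxy] at hy1
    have hx0 : affineForm a b c x = 0 := hx.1
    have hy0 : affineForm a b c y = 0 := hy.1
    by_contra hne
    have hst : s x - s y ≠ 0 := by
      intro h
      apply hne
      rw [← hx1, ← hy1, sub_eq_zero.1 h]
    rw [← hx1, affineForm_lineMap] at hx0
    rw [← hy1, affineForm_lineMap] at hy0
    have h1 : affineForm a b c (v (k x + 1)) - affineForm a b c (v (k x)) = 0 := by
      refine (mul_eq_zero.1 ?_).resolve_left hst
      linear_combination hx0 - hy0
    have h2 : affineForm a b c (v (k x)) = 0 := by linear_combination hx0 - s x * h1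
    exact hnot (k x) hkn ⟨h2, by linarith⟩
  calc _ ≤ (K : Set ℕ).encard := encard_le_encard_of_injOn (fun x hx => hkK x hx) hinjOn
    _ = K.card := encard_coe_eq_coe_finsetCard K
    _ ≤ D := by exact_mod_cast hKcard

/-- Two sides of a polygon that share a vertex meet only there. -/
theorem lineMap_ne_lineMap_of_not_collinear {p q r : Plane} (h : ¬ Collinear ℝ {r, q, p}) {s t : ℝ}
    (hs : s ∈ Ico (0 : ℝ) 1) : AffineMap.lineMap p q s ≠ AffineMap.lineMap q r t := by
  intro heq
  have hpq : p ≠ q := by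
    rintro rfl
    exact h (by simpa using collinear_pair ℝ r p)
  by_cases ht : t = 0
  · rw [ht, AffineMap.lineMap_apply_zero] at heq
    have : AffineMap.lineMap p q s = AffineMap.lineMap p q (1 : ℝ) := by simp [heq]
    exact hs.2.ne (AffineMap.lineMap_injective ℝ hpq this)
  · refine h (collinear_insert_of_mem_affineSpan_pair ?_)
    have : r = AffineMap.lineMap q p ((1 - s) / t) := by
      simp only [AffineMap.lineMap_apply_module] at heq ⊢
      have h1 : t • r = t • ((1 - (1 - s) / t) • q + ((1 - s) / t) • p) := by
        rw [smul_add, smul_smul, smul_smul, mul_div_cancel₀ _ ht, mul_sub, mul_div_cancel₀ _ ht]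
        linear_combination (norm := module) (-1 : ℝ) • heq
      exact smul_right_injective Plane ht h1
    rw [this]
    exact AffineMap.lineMap_mem_affineSpan_pair _ _ _

/-- Replacing two crossing segments by two other segments shortens the total length. -/
theorem dist_add_dist_lt_of_crossing {p q r s x : Plane} (h₁ : ¬ Collinear ℝ {q, p, r})
    (h₂ : ¬ Collinear ℝ {p, r, s}) (hx : x ∈ segment ℝ p q) (hx' : x ∈ segment ℝ r s) :
    dist p r + dist q s < dist p q + dist r s := by
  have hpq := dist_add_dist_of_mem_segment hx
  have hrs := dist_add_dist_of_mem_segment hx'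
  -- Equality would put `x` on the segment from `p` to `r`. Then either `x = p` lies on the line
  -- through `r` and `s`, or `q` lies on the line through `p` and `r`.
  have hlt : dist p r < dist p x + dist x r := by
    refine lt_of_le_of_ne (dist_triangle p x r) fun h => ?_
    have hw : Wbtw ℝ p x r := dist_add_dist_eq_iff.1 h.symm
    by_cases hxp : x = p
    · refine h₂ (collinear_insert_of_mem_affineSpan_pair ?_)
      rw [← hxp]
      exact (mem_segment_iff_wbtw.1 hx').mem_affineSpan
    · obtain ⟨α, hα, rfl⟩ := hw
      rw [segment_eq_image_lineMap] at hx
      obtain ⟨β, hβ, hβx⟩ := hx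
      have hβ0 : β ≠ 0 := by
        rintro rfl
        simp only [AffineMap.lineMap_apply_zero] at hβx
        exact hxp hβx.symm
      refine h₁ (collinear_insert_of_mem_affineSpan_pair ?_)
      have : q = AffineMap.lineMap p r (α / β) := by
        simp only [AffineMap.lineMap_apply_module] at hβx ⊢
        have h1 : β • q = β • ((1 - α / β) • p + (α / β) • r) := by
          rw [smul_add, smul_smul, smul_smul, mul_div_cancel₀ _ hβ0, mul_sub,
            mul_div_cancel₀ _ hβ0]
          linear_combination (norm := module) (1 : ℝ) • hβx
        exact smul_right_injective Plane hβ0 h1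
      rw [this]
      exact AffineMap.lineMap_mem_affineSpan_pair _ _ _
  have hle := dist_triangle q x s
  rw [dist_comm q x] at hle
  rw [dist_comm r x] at hrs
  linarith

/-- Both sides have the same parity, so the bound could fail only with `p, q` on one side of the
line and `r, s` on the other. The common point `x` would then lie strictly on both sides. -/
theorem signFlip_add_signFlip_le_of_crossing {p q r s x : Plane} {a b c : ℝ}
    (hp : affineForm a b c p ≠ 0) (hq : affineForm a b c q ≠ 0) (hr : affineForm a b c r ≠ 0)
    (hs : affineForm a b c s ≠ 0) (hx : x ∈ segment ℝ p q) (hx' : x ∈ segment ℝ r s) :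
    signFlip (fun p => 0 < affineForm a b c p) p r + signFlip (fun p => 0 < affineForm a b c p) q s ≤
      signFlip (fun p => 0 < affineForm a b c p) p q +
        signFlip (fun p => 0 < affineForm a b c p) r s := by
  have hpos : ∀ u w : Plane, x ∈ segment ℝ u w → 0 < affineForm a b c u →
      0 < affineForm a b c w → 0 < affineForm a b c x := by
    intro u w h hu hw
    rw [segment_eq_image_lineMap] at h
    obtain ⟨t, ht, rfl⟩ := h
    rw [affineForm_lineMap]
    rcases ht.1.eq_or_lt with rfl | h0
    · linarith
    · have := mul_pos h0 hw
      have := mul_nonneg (sub_nonneg.2 ht.2) hu.le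
      linarith
  have hneg : ∀ u w : Plane, x ∈ segment ℝ u w → affineForm a b c u < 0 →
      affineForm a b c w < 0 → affineForm a b c x < 0 := by
    intro u w h hu hw
    rw [segment_eq_image_lineMap] at h
    obtain ⟨t, ht, rfl⟩ := h
    rw [affineForm_lineMap]
    rcases ht.1.eq_or_lt with rfl | h0
    · linarith
    · have := mul_neg_of_pos_of_neg h0 hw
      have := mul_nonpos_of_nonneg_of_nonpos (sub_nonneg.2 ht.2) hu.le
      linarith
  rcases lt_or_gt_of_ne hp with hp | hp <;> rcases lt_or_gt_of_ne hq with hq | hq <;>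
    rcases lt_or_gt_of_ne hr with hr | hr <;> rcases lt_or_gt_of_ne hs with hs | hs
  all_goals first
    | exact absurd (hpos _ _ hx hp hq) (hneg _ _ hx' hr hs).le.not_gt
    | exact absurd (hpos _ _ hx' hr hs) (hneg _ _ hx hp hq).le.not_gt
    | simp only [signFlip, hp, hq, hr, hs, hp.le.not_gt, hq.le.not_gt, hr.le.not_gt, hs.le.not_gt,
        if_true, if_false, iff_true, iff_false, not_true, iff_self]
      norm_num

end Polygons

/-! ### From tours to simple polygons -/

section Tours

open Set

theorem curveDegree_le_of_isDCurve {X J : Set Plane} {d : ℕ∞} (hJ : IsDCurve d J) (hX : X ⊆ J) :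
    curveDegree X ≤ d := sInf_le ⟨J, hJ, hX⟩

theorem curveDegree_mono {X Y : Set Plane} (h : X ⊆ Y) : curveDegree X ≤ curveDegree Y :=
  sInf_le_sInf fun _ ⟨J, hJ, hY⟩ => ⟨J, hJ, h.trans hY⟩

/-- A tour through all points of a set in general position can be uncrossed without increasing the
number of times it crosses any line. -/
theorem curveDegree_le_of_cycSum_le (X : Finset Plane) (hX : InGeneralPosition (X : Set Plane))
    (hcard : 3 ≤ X.card) (l₀ : List Plane) (hl₀ : l₀.Nodup) (hmem₀ : ∀ p, p ∈ l₀ ↔ p ∈ X) (D : ℕ)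
    (hD₀ : ∀ a b c, (∀ p ∈ X, affineForm a b c p ≠ 0) →
      cycSum (signFlip fun p => 0 < affineForm a b c p) l₀ ≤ D) :
    curveDegree (X : Set Plane) ≤ D := by
  classical
  -- The minimization is restricted to tours obeying the crossing bound; uncrossing stays in this
  -- finite set and strictly reduces length.
  let S : Set (List Plane) := {l | (l.Nodup ∧ ∀ p, p ∈ l ↔ p ∈ X) ∧
    ∀ a b c, (∀ p ∈ X, affineForm a b c p ≠ 0) →
      cycSum (signFlip fun p => 0 < affineForm a b c p) l ≤ D}
  have hSfin : S.Finite := by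
    refine (List.finite_toSet X.toList.permutations).subset fun l hl => ?_
    refine List.mem_permutations.2
      ((List.perm_ext_iff_of_nodup hl.1.1 X.nodup_toList).2 fun p => ?_)
    rw [hl.1.2, Finset.mem_toList]
  obtain ⟨l, ⟨⟨hnd, hmem⟩, hD⟩, hmin⟩ :=
    exists_min_image S (cycSum dist) hSfin ⟨l₀, ⟨hl₀, hmem₀⟩, hD₀⟩
  have hlX : l.toFinset = X := by ext p; rw [List.mem_toFinset, hmem]
  have hlen : l.length = X.card := by rw [← hlX, List.toFinset_card_of_nodup hnd]
  set n := l.length with hn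
  have hn3 : 3 ≤ n := hlen ▸ hcard
  set v : ℕ → Plane := fun k => l.getD (k % n) 0 with hv
  have hmod : ∀ k, k % n < n := fun k => Nat.mod_lt _ (by omega)
  have hget : ∀ k, l[k % n]? = some (v k) := by
    intro k
    rw [hv]
    simp only
    rw [List.getD_eq_getElem _ _ (hmod k), List.getElem?_eq_getElem (hmod k)]
  have hvX : ∀ i, v i ∈ X := fun i => (hmem _).1 (List.mem_of_getElem? (hget i))
  have hclose : v n = v 0 := by simp [hv]
  have hinj : ∀ i < n, ∀ j < n, v i = v j → i = j := by
    intro i hi j hj h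
    have h1 := hget i
    have h2 := hget j
    rw [Nat.mod_eq_of_lt hi] at h1
    rw [Nat.mod_eq_of_lt hj] at h2
    exact (List.getElem?_inj hi hnd).1 (by rw [h1, h2, h])
  have hsucc : ∀ i < n, ∃ i' < n, v (i + 1) = v i' ∧ (i' = i + 1 ∨ (i' = 0 ∧ i + 1 = n)) := by
    intro i hi
    rcases Nat.lt_or_ge (i + 1) n with h | h
    · exact ⟨i + 1, h, rfl, Or.inl rfl⟩
    · have : i + 1 = n := by omega
      exact ⟨0, by omega, by rw [this, hclose], Or.inr ⟨rfl, this⟩⟩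
  have hedge : ∀ i < n, v i ≠ v (i + 1) := by
    intro i hi h
    obtain ⟨i', hi', hvi, hcase⟩ := hsucc i hi
    have := hinj i hi i' hi' (h.trans hvi)
    omega
  have hcross : ∀ i j, i < j → j < n → v i ≠ v j → v i ≠ v (j + 1) → v (i + 1) ≠ v j →
      v (i + 1) ≠ v (j + 1) →
      ∀ x, x ∈ segment ℝ (v i) (v (i + 1)) → x ∉ segment ℝ (v j) (v (j + 1)) := by
    intro i j hij hj h1 h2 h3 h4 x hx hx'
    -- After rotation the tour starts at `v (i + 1)`. Reversing its part up to `v j` replaces the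
    -- two crossing sides by `v i, v j` and `v (i + 1), v (j + 1)`.
    set l' := l.rotate (i + 1) with hl'
    have hlen' : l'.length = n := List.length_rotate ..
    have hget' : ∀ k < n, l'[k]? = some (v (k + (i + 1))) := fun k hk => by
      rw [hl', List.getElem?_rotate hk, hget]
    set u := l'.take (j - i) with hu
    set w := l'.drop (j - i) with hw
    have huw : u ++ w = l' := List.take_append_drop _ _
    have hu1 : u.head? = some (v (i + 1)) := by
      rw [hu, List.head?_take, if_neg (by omega), List.head?_eq_getElem?, hget' 0 (by omega)]
      simp
    have hu2 : u.getLast? = some (v j) := by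
      rw [hu, List.getLast?_take, if_neg (by omega), hget' _ (by omega),
        show j - i - 1 + (i + 1) = j by omega]
      simp
    have hw1 : w.head? = some (v (j + 1)) := by
      rw [hw, List.head?_drop, hget' _ (by omega), show j - i + (i + 1) = j + 1 by omega]
    have hw2 : w.getLast? = some (v i) := by
      rw [hw, List.getLast?_drop, if_neg (by omega), List.getLast?_eq_getElem?, hlen',
        hget' _ (by omega), show n - 1 + (i + 1) = i + n by omega]
      simp [hv]
    have hperm : (u.reverse ++ w).Perm l :=
      ((List.reverse_perm u).append_right w).trans (huw ▸ List.rotate_perm l (i + 1))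
    have hlt := dist_add_dist_lt_of_crossing
      (hX _ (hvX _) _ (hvX _) _ (hvX _) (hedge i (by omega)).symm h3 h1)
      (hX _ (hvX _) _ (hvX _) _ (hvX _) h1 h2 (hedge j hj)) hx hx'
    have hmem' : u.reverse ++ w ∈ S := by
      refine ⟨⟨hperm.nodup_iff.2 hnd, fun p => by rw [hperm.mem_iff, hmem]⟩, fun a b c h0 => ?_⟩
      obtain ⟨e, he, he'⟩ := cycSum_reverse_append (signFlip fun p => 0 < affineForm a b c p)
        (signFlip_comm _) _ _ _ _ u w hu1 hu2 hw1 hw2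
      have hold := hD a b c h0
      rw [← cycSum_rotate _ l (i + 1), ← hl', ← huw, he] at hold
      rw [he']
      have := signFlip_add_signFlip_le_of_crossing (h0 _ (hvX _)) (h0 _ (hvX _)) (h0 _ (hvX _))
        (h0 _ (hvX _)) hx hx'
      omega
    obtain ⟨e, he, he'⟩ := cycSum_reverse_append (dist : Plane → Plane → ℝ) dist_comm _ _ _ _ u w
      hu1 hu2 hw1 hw2
    have hold := hmin _ hmem'
    rw [← cycSum_rotate _ l (i + 1), ← hl', ← huw, he, he'] at hold
    linarith
  have hsimple : ∀ i j, i < j → j < n → ∀ s ∈ Ico (0 : ℝ) 1, ∀ t ∈ Ico (0 : ℝ) 1,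
      AffineMap.lineMap (v i) (v (i + 1)) s ≠ AffineMap.lineMap (v j) (v (j + 1)) t := by
    intro i j hij hj s hs t ht
    have hi : i < n := by omega
    obtain ⟨i', hi', hvi, hci⟩ := hsucc i hi
    obtain ⟨j', hj', hvj, hcj⟩ := hsucc j hj
    have h1 : v i ≠ v j := fun h => by have := hinj i hi j hj h; omega
    have h4 : v (i + 1) ≠ v (j + 1) := fun h => by
      have := hinj i' hi' j' hj' (by rw [← hvi, ← hvj, h])
      omega
    -- Sides sharing a vertex, including the pair at the wrap-around, are handled by general
    -- position instead of uncrossing.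
    by_cases h3 : v (i + 1) = v j
    · have hji : j = i' := hinj j hj i' hi' (by rw [← h3, hvi])
      have h2 : v i ≠ v (j + 1) := fun h => by
        have := hinj i hi j' hj' (h.trans hvj)
        omega
      rw [← h3]
      exact lineMap_ne_lineMap_of_not_collinear
        (hX _ (hvX _) _ (hvX _) _ (hvX _) h4.symm h2.symm (hedge i hi).symm) hs
    · by_cases h2 : v i = v (j + 1)
      · rw [h2]
        refine (lineMap_ne_lineMap_of_not_collinear
          (hX _ (hvX _) _ (hvX _) _ (hvX _) ?_ h3 (hedge j hj).symm) ht).symm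
        rw [← h2]
        exact (hedge i hi).symm
      · intro heq
        refine hcross i j hij hj h1 h2 h3 h4 (AffineMap.lineMap (v i) (v (i + 1)) s) ?_ ?_
        · rw [segment_eq_image_lineMap]; exact ⟨s, ⟨hs.1, hs.2.le⟩, rfl⟩
        · rw [heq, segment_eq_image_lineMap]; exact ⟨t, ⟨ht.1, ht.2.le⟩, rfl⟩
  refine curveDegree_le_of_isDCurve (J := closedPolygon v n) ⟨?_, ?_⟩ fun p hp => ?_
  · refine isJordanCurve_closedPolygon v n (by omega) hclose hedge fun i hi j hj hij s hs t ht => ?_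
    rcases lt_or_gt_of_ne hij with h | h
    · exact hsimple i j h hj s hs t ht
    · exact (hsimple j i h hi t ht s hs).symm
  · refine stab_closedPolygon_le X hX v n hclose hvX hinj hedge D fun a b c h0 => ?_
    rw [← cycSum_eq_sum_range _ 0 l]
    exact hD a b c h0
  · obtain ⟨i, hi, rfl⟩ := List.mem_iff_getElem.1 ((hmem p).2 hp)
    refine ⟨i, hi, 0, by simp, ?_⟩
    rw [AffineMap.lineMap_apply_zero, hv]
    simp only
    rw [Nat.mod_eq_of_lt hi, List.getD_eq_getElem _ _ hi]

theorem cycSum_signFlip_le_length {α : Type*} [Inhabited α] (P : α → Prop) (l : List α) :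
    cycSum (signFlip P) l ≤ l.length := by
  rw [cycSum_eq_sum_range _ default]
  calc _ ≤ ∑ _k ∈ Finset.range l.length, 1 :=
        Finset.sum_le_sum fun k _ => signFlip_le_one P _ _
    _ = l.length := by simp

/-- Any two points lie on a triangle. -/
theorem curveDegree_pair_le {p q : Plane} (hpq : p ≠ q) : curveDegree ({p, q} : Set Plane) ≤ 3 := by
  classical
  obtain ⟨r, hr⟩ : ∃ r, r ∉ affineSpan ℝ ({p, q} : Set Plane) := by
    by_contra! h
    have htop : affineSpan ℝ ({p, q} : Set Plane) = ⊤ := by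
      ext x; simp [h x]
    have h1 := collinear_pair ℝ p q
    rw [collinear_iff_finrank_le_one] at h1
    have h2 : vectorSpan ℝ ({p, q} : Set Plane) = ⊤ := by
      rw [← direction_affineSpan, htop, AffineSubspace.direction_top]
    rw [h2, finrank_top, finrank_euclideanSpace_fin] at h1
    omega
  have hcol : ¬ Collinear ℝ {p, q, r} := by
    intro h
    exact hr (h.mem_affineSpan_of_mem_of_ne (by simp) (by simp) (by simp) hpq)
  have hpr : p ≠ r := fun h => hr (h ▸ left_mem_affineSpan_pair ℝ p q)
  have hqr : q ≠ r := fun h => hr (h ▸ right_mem_affineSpan_pair ℝ p q)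
  have hX : InGeneralPosition ((({p, q, r} : Finset Plane) : Set Plane)) := by
    intro x hx y hy z hz hxy hxz hyz h
    refine hcol ?_
    have hsub : ({x, y, z} : Finset Plane) ⊆ {p, q, r} := by
      intro t ht
      simp only [Finset.mem_insert, Finset.mem_singleton] at ht
      rcases ht with rfl | rfl | rfl <;> assumption
    have heq : ({x, y, z} : Finset Plane) = {p, q, r} := by
      refine Finset.eq_of_subset_of_card_le hsub ?_
      rw [Finset.card_eq_three.2 ⟨x, y, z, hxy, hxz, hyz, rfl⟩]
      exact Finset.card_le_three
    have := congrArg (fun s : Finset Plane => (s : Set Plane)) heq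
    simp only [Finset.coe_insert, Finset.coe_singleton] at this
    rwa [← this]
  refine (curveDegree_mono (Y := ((({p, q, r} : Finset Plane) : Set Plane))) ?_).trans
    (curveDegree_le_of_cycSum_le {p, q, r} hX ?_ [p, q, r] ?_ ?_ 3 fun a b c _ =>
      cycSum_signFlip_le_length _ _)
  · intro x hx
    simp only [mem_insert_iff, mem_singleton_iff] at hx
    rcases hx with rfl | rfl <;> simp
  · exact (Finset.card_eq_three.2 ⟨p, q, r, hpq, hpr, hqr, rfl⟩).ge
  · simp [hpq, hpr, hqr]
  · simp

theorem curveDegree_le_three_of_card_lt (X : Finset Plane) (hX : X.card < 3) :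
    curveDegree (X : Set Plane) ≤ 3 := by
  classical
  obtain ⟨p, q, hpq, hsub⟩ : ∃ p q : Plane, p ≠ q ∧ (X : Set Plane) ⊆ {p, q} := by
    have hcases : X.card = 0 ∨ X.card = 1 ∨ X.card = 2 := by omega
    rcases hcases with h | h | h
    · obtain ⟨p, q, hpq⟩ := exists_pair_ne Plane
      exact ⟨p, q, hpq, by simp [Finset.card_eq_zero.1 h]⟩
    · obtain ⟨p, rfl⟩ := Finset.card_eq_one.1 h
      obtain ⟨q, hq⟩ := exists_ne p
      exact ⟨p, q, hq.symm, by simp⟩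
    · obtain ⟨p, q, hpq, rfl⟩ := Finset.card_eq_two.1 h
      exact ⟨p, q, hpq, by simp⟩
  exact (curveDegree_mono hsub).trans (curveDegree_pair_le hpq)

end Tours

/-! ### Assembling the bound -/

theorem theorem4p6 :
    ∃ C : ℝ, 0 < C ∧ ∃ m₀ : ℕ, ∀ m : ℕ, m₀ ≤ m →
      ∀ (A : Fin m → Finset Plane) (B : Fin m → Set Plane),
        InGeneralPosition (⋃ i, (A i : Set Plane)) →
        (∀ i j, i ≠ j → LinearlySeparable (A i : Set Plane) (A j : Set Plane)) →
        (∀ i, IsDCurve (curveDegree (A i : Set Plane)) (B i) ∧ (A i : Set Plane) ⊆ B i) →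
        (∀ i j, i ≠ j → (B i ∩ B j).Countable) →
        (curveDegree (⋃ i, (A i : Set Plane)) : ℝ≥0∞) ≤
          (stab (⋃ i, B i) : ℝ≥0∞) + ENNReal.ofReal (C * √(m : ℝ)) := by
  classical
  -- Here 204 comes from the connecting path, and one more `√m ≥ 1` absorbs the closing edge.
  refine ⟨205, by norm_num, 1, fun m hm A B hGP _ hB hcount => ?_⟩
  have hm1 : 1 ≤ √(m : ℝ) := Real.one_le_sqrt.2 (by exact_mod_cast hm)
  set X : Finset Plane := Finset.univ.biUnion A with hX
  have hXU : (⋃ i, (A i : Set Plane)) = (X : Set Plane) := by simp [hX]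
  rw [hXU] at hGP ⊢
  rcases Nat.lt_or_ge X.card 3 with hlt | hge
  · calc (curveDegree (X : Set Plane) : ℝ≥0∞) ≤ ((3 : ℕ∞) : ℝ≥0∞) :=
          ENat.toENNReal_mono (curveDegree_le_three_of_card_lt X hlt)
      _ = ENNReal.ofReal 3 := by simp
      _ ≤ ENNReal.ofReal (205 * √(m : ℝ)) := ENNReal.ofReal_le_ofReal (by linarith)
      _ ≤ _ := le_add_self
  rcases eq_or_ne (stab (⋃ i, B i)) ⊤ with htop | htop
  · simp [htop]
  obtain ⟨s, hs⟩ := ENat.ne_top_iff_exists.1 htop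
  have hwalk : ∀ i, ∃ (W : List Plane) (p : Plane),
      ((A i).Nonempty → W.head? = some p ∧ W.getLast? = some p) ∧ (∀ q, q ∈ W ↔ q ∈ A i) ∧
      ∀ a b c, (∀ q ∈ A i, affineForm a b c q ≠ 0) →
        ((pathSum (signFlip fun q => 0 < affineForm a b c q) W : ℕ) : ℕ∞) ≤
          ({q | affineForm a b c q = 0} ∩ B i).encard := by
    intro i
    rcases (A i).eq_empty_or_nonempty with h | h
    · exact ⟨[], 0, by simp [h], by simp [h], by simp [pathSum]⟩
    · obtain ⟨W, p, h1, h2, h3, h4⟩ := (hB i).1.1.exists_closed_walk (A i) h (hB i).2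
      exact ⟨W, p, fun _ => ⟨h1, h2⟩, h3, h4⟩
  choose W r hends hWmem hWle using hwalk
  have hAX : ∀ i, ∀ q ∈ A i, q ∈ X := fun i q hq =>
    Finset.mem_biUnion.2 ⟨i, Finset.mem_univ _, hq⟩
  have hsum : ∀ a b c, (∀ q ∈ X, affineForm a b c q ≠ 0) →
      ∑ i, pathSum (signFlip fun q => 0 < affineForm a b c q) (W i) ≤ s := by
    intro a b c h0
    have h1 := sum_pathSum_signFlip_le_stab B (fun i => (hB i).1.1) hcount W X
      (fun i q hq => hAX i q ((hWmem i q).1 hq))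
      (fun i a b c h0 => hWle i a b c fun q hq => h0 q (hAX i q hq)) a b c h0
    rw [← hs] at h1
    exact_mod_cast h1
  -- Empty sets have an empty walk and no genuine base point, so only the others are connected.
  let ι := {i : Fin m // (A i).Nonempty}
  obtain ⟨l, hnd, hl, hlr⟩ := exists_path_low_stabbing fun i : ι => r i
  have hcardι : (Fintype.card ι : ℝ) ≤ m := by
    exact_mod_cast (Fintype.card_subtype_le _).trans_eq (Fintype.card_fin m)
  set N := ⌊204 * √(m : ℝ)⌋₊ with hN
  set walk := l.flatMap fun i : ι => W i with walk_def
  have hmemwalk : ∀ p, p ∈ walk.dedup ↔ p ∈ X := by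
    intro p
    rw [List.mem_dedup, walk_def, List.mem_flatMap, hX, Finset.mem_biUnion]
    constructor
    · rintro ⟨i, _, hp⟩
      exact ⟨i, Finset.mem_univ _, (hWmem i p).1 hp⟩
    · rintro ⟨i, _, hp⟩
      exact ⟨⟨i, p, hp⟩, hl _, (hWmem i p).2 hp⟩
  -- The three terms count crossings by the closed walks, by the path of base points, and by the
  -- edge closing the tour.
  have hcross : ∀ a b c, (∀ p ∈ X, affineForm a b c p ≠ 0) →
      cycSum (signFlip fun p => 0 < affineForm a b c p) walk.dedup ≤ s + N + 1 := by
    intro a b c h0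
    refine (cycSum_signFlip_le _ _).trans (Nat.add_le_add_right
      ((pathSum_signFlip_le_of_sublist _ (List.dedup_sublist walk)).trans ?_) 1)
    rw [walk_def, pathSum_signFlip_flatMap _ _ (fun i : ι => r i) l (fun i _ => (hends i i.2).1)
      (fun i _ => (hends i i.2).2)]
    refine Nat.add_le_add (le_trans ?_ (hsum a b c h0)) (Nat.le_floor ((hlr a b c).trans ?_))
    · rw [← List.sum_toFinset _ hnd]
      calc _ ≤ ∑ i : ι, pathSum (signFlip fun q => 0 < affineForm a b c q) (W i) :=
            Finset.sum_le_sum_of_subset (Finset.subset_univ _)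
        _ = ∑ i ∈ Finset.univ.map (Function.Embedding.subtype fun i => (A i).Nonempty),
            pathSum (signFlip fun q => 0 < affineForm a b c q) (W i) := by
            rw [Finset.sum_map]; rfl
        _ ≤ _ := Finset.sum_le_sum_of_subset (Finset.subset_univ _)
    · gcongr
  have hdeg := curveDegree_le_of_cycSum_le X hGP hge walk.dedup (List.nodup_dedup _) hmemwalk
    (s + N + 1) hcross
  calc (curveDegree (X : Set Plane) : ℝ≥0∞) ≤ (((s + N + 1 : ℕ) : ℕ∞) : ℝ≥0∞) :=
        ENat.toENNReal_mono hdeg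
    _ = (s : ℝ≥0∞) + ENNReal.ofReal ((N + 1 : ℕ) : ℝ) := by
        rw [ENNReal.ofReal_natCast, ENat.toENNReal_coe]
        push_cast
        ring
    _ ≤ _ := by
        rw [← hs, ENat.toENNReal_coe]
        gcongr
        push_cast
        have : (N : ℝ) ≤ 204 * √(m : ℝ) := Nat.floor_le (by positivity)
        linarith
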